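/- **Conventions.** Variables are typed, clocks are variables with domain $\mathbb{R}_{\ge 0}$. Valuations are functions on sets of variables. $f\rhd g$ is the function on $dom(f)\cup dom(g)$ that equals $f$ on $dom(f)$ and $g$ elsewhere; $f\heartsuit g$ means that $f,g$ agree on $dom(f)\cap dom(g)$, and then $f\|g:=f\rhd g$; $f[g]:=(g\rhd f)\lceil dom(f)$; $v\oplus d$ adds $d$ to all clocks. A property over $V$ is a set $P\subseteq Val(V)$; $v\models P$ means $v\lceil V\in P$; $P$ does not depend on $W\subseteq V$ if $v\models P\Leftrightarrow v[u]\models P$ for all $v\in Val(V)$, $u\in Val(W)$. $\Delta$ and $\mathcal C$ are the sets of broadcast and binary channels. Actions are $\delta!,\delta?$ ($\delta\in\Delta$), $c!,c?$ ($c\in\mathcal C$), $\tau$ and delays $d\in\mathbb{R}_{\ge0}$. **Timed automata.** $\mathcal A=\langle L,K,l^0,E,H,v^0,I,\to,\to^u\rangle$ has locations $L$, committed locations $K\subseteq L$, an initial location $l^0$, disjoint sets $E,H$ of external and internal variables ($V=E\cup H$), $v^0\in Val(V)$, left-closed invariants $I(l)\subseteq Val(V)$ ($v\oplus d\models I(l)\Rightarrow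 v\models I(l)$) with $v^0\models I(l^0)$, transitions $l\xrightarrow{g,a,\rho}l'$ with $a$ not a delay, $\rho:Val(V)\to Val(V)$ and $g$ a conjunction of comparisons of clocks or differences of two clocks with constants and of conditions not involving clocks, and urgent transitions $\to^u\subseteq\to$. We require: $I(l)$ does not depend on $E$; guards of $\delta?$- and $c?$-transitions do not depend on $E$; for $l\in K$ and $v\in I(l)$ there is $l\xrightarrow{g,a,\rho}l'$ with $v\models g$ and $\rho(v)\models I(l')$; urgent transitions have action $\tau$ and guards not depending on clocks; and $\rho(v)\lceil E=v\lceil E$ for $\delta?$-transitions. A network (NTA) is a finite sequence of automata that are pairwise compatible ($H_1\cap V_2=H_2\cap V_1=\emptyset$, $v^0_1\heartsuit v^0_2$), with distinct fresh location variables $\mathsf{loc}_k$ of type $L_k$. **Semantics of a network $\langle\mathcal A_1,\dots,\mathcal A_n\rangle$.** States are the valuations $s$ of $\bigcup_k(V_k\cup\{\mathsf{loc}_k\})$ with $s\models I_k(s(\mathsf{loc}_k))$ for all $k$; the initial state is given by all $v^0_k$ and $l^0_k$. A transition $l\xrightarrow{g,a,\rho}l'$ of $\mathcal A_k$ is enabled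 in $s$ if $s(\mathsf{loc}_k)=l$ and $s\models g$; taking it changes $s$ to $s[\rho(s\lceil V_k)][\mathsf{loc}_k\mapsto l']$. Steps between states are: an enabled $\tau$-transition; an enabled $c!$-transition and then an enabled $c?$-transition of another automaton; an enabled $\delta!$-transition of $\mathcal A_i$ and then, in the order of the network, one enabled $\delta?$-transition of each $\mathcal A_j$, $j\ne i$, that has one (enabledness always refers to $s$); in these three cases no automaton is in a committed location in $s$, or some participating transition starts in one; and $s\to s\oplus d$ if no automaton is in a committed location and no urgent transition is enabled. $\mathcal N\models\forall\square P$ ($P$ is a safety property of $\mathcal N$) means that $s\models P$ for all reachable states $s$. **TTSBs.** A TTSB has external and internal variables $E,H$, states $S\subseteq Val(E\cup H)$, an initial state $s^0$ and transitions $s\xrightarrow{a,b}t$, $b\in\{0,1\}$, committed if $b=1$. $Comm(s)$ means that $s$ has an outgoing committed transition. $\mathsf{TTSB}(\mathcal A)$ has external variables $E$, internal variables $H\cup\{\mathsf{loc}\}$, states the $v\in Val(E\cup H\cup\{\mathsf{loc}\})$ with $v\models I(v(\mathsf{loc}))$, initial state $v^0\|\{\mathsf{loc}\mapsto l^0\}$,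 and the following transitions between states: $s\xrightarrow{a,b}s[\rho(s\lceil V)][\mathsf{loc}\mapsto l']$ for each enabled $l\xrightarrow{g,a,\rho}l'$, where $b=1$ iff $l\in K$; $s\xrightarrow{d,0}s\oplus d$ if $s(\mathsf{loc})\notin K$ and no urgent transition is enabled; $s\xrightarrow{\delta?,0}s$ if no $\delta?$-transition is enabled. $\mathcal T_1\|\mathcal T_2$ has external variables $E_1\cup E_2$, internal variables $H_1\cup H_2$, states $r\|s$ ($r\in S_1,s\in S_2,r\heartsuit s$), initial state $s^0_1\|s^0_2$, and, for $\{i,j\}=\{1,2\}$, $r\in S_i$, $s\in S_j$, $r\heartsuit s$, the transitions * $r\|s\xrightarrow{a,b}r'\rhd s$ if $r\xrightarrow{a,b}_ir'$ with $a\in\{c!,c?\}$, or with $a=\tau$ and ($Comm(s)\Rightarrow b=1$); * $r\|s\xrightarrow{\tau,b\vee b'}s'\rhd r'$ if $r\xrightarrow{c!,b}_ir'$, $s[r']\xrightarrow{c?,b'}_js'$ and ($Comm(r)\vee Comm(s)\Rightarrow b\vee b'=1$); * $r\|s\xrightarrow{\delta!,b\vee b'}r'\|s'$ if $r\xrightarrow{\delta!,b}_ir'$,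 $s[r']\xrightarrow{\delta?,b'}_js'$; * $r\|s\xrightarrow{\delta?,b\vee b'}r'\|s'$ if $r\xrightarrow{\delta?,b}_ir'$, $s\xrightarrow{\delta?,b'}_js'$; * $r\|s\xrightarrow{d,0}r'\|s'$ if $r\xrightarrow{d,0}_ir'$, $s\xrightarrow{d,0}_js'$. For a set $C$ of channels and variables, $\mathcal T\backslash C$ arises from $\mathcal T$ by making the external variables in $C$ internal, removing all transitions with actions $\delta?,c!,c?$ on channels in $C$, replacing $s\xrightarrow{\delta!,b}s'$ with $\delta\in C$ by $s\xrightarrow{\tau,b}s'$ if $Comm(s)\Rightarrow b=1$ (with $Comm$ taken in $\mathcal T$), and removing it otherwise. $\mathcal T_1,\mathcal T_2$ are comparable if $E_1=E_2$. $\mathcal T_1\preceq\mathcal T_2$ means that there is $R\subseteq S_1\times S_2$ with $s^0_1\,R\,s^0_2$ such that $r\,R\,s$ implies: $r\lceil E_1=s\lceil E_2$; $r[u]\,R\,s[u]$ for all $u\in Val(E_1)$; $Comm(s)\Rightarrow Comm(r)$; and if $r\xrightarrow{a,b}r'$ then $s\xrightarrow{a,b}s'$ with $r'\,R\,s'$ for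 some $s'$, or $a=\tau$ and $r'\,R\,s$. A binary channel is *used* by $\mathcal T$ if it labels a transition of $\mathcal T$. A broadcast channel $\delta$ is used by $\mathcal T$ unless $\mathcal T$ has no $\delta!$-transition and the $\delta?$-transitions of $\mathcal T$ are exactly the uncommitted self-loops $s\xrightarrow{\delta?,0}s$, $s\in S$. **Theorem.** Let $\mathcal N=\langle\mathcal A_1,\dots,\mathcal A_i,\mathcal A_{i+1},\dots,\mathcal A_n\rangle$ and $\mathcal N'=\langle\mathcal B_1,\dots,\mathcal B_j,\mathcal A_{i+1},\dots,\mathcal A_n\rangle$ be NTAs with $1\le i<n$ and $j\ge1$, and let $P$ be a property over $\hat V=\bigcup_{k=i+1}^n(V_k\cup\{\mathsf{loc}_k\})$. Let $\hat E=\bigcup_{k=1}^iE_k-\hat V$, let $\mathcal T_c=\mathsf{TTSB}(\mathcal A_{i+1})\|\cdots\|\mathsf{TTSB}(\mathcal A_n)$, let $\Sigma\subseteq\Delta\cup\mathcal C$ be any set that contains all channels used by $\mathcal T_c$, and let $$\mathcal T_a=(\mathsf{TTSB}(\mathcal A_1)\|\cdots\|\mathsf{TTSB}(\mathcal A_i))\backslash(\Delta\cup\mathcal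 C\cup\hat E-\Sigma),\qquad \mathcal T_b=(\mathsf{TTSB}(\mathcal B_1)\|\cdots\|\mathsf{TTSB}(\mathcal B_j))\backslash(\Delta\cup\mathcal C\cup\hat E-\Sigma).$$ Assume that $\mathcal T_a$ and $\mathcal T_b$ are comparable and $\mathcal T_a\preceq\mathcal T_b$, and that every committed state of $\mathcal T_a\|\mathcal T_c$ has an outgoing committed transition whose action is not of the form $\delta?$, $c!$ or $c?$. If one of $\mathcal A_1,\dots,\mathcal A_i$ has an urgent transition, assume also that every state of $\mathcal T_b$ in which some $\mathcal B_k$ is in a committed location is a committed state of $\mathcal T_b$. If $P$ is a safety property of $\mathcal N'$, then $P$ is a safety property of $\mathcal N$. -/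

import Mathlib

open scoped NNReal

/-- The ambient data: clock names, names and domains of the other variables, names of timed automata
with their sets of locations, broadcast channels and binary channels. -/
structure Sig where
  /-- names of clocks -/
  Clock : Type
  /-- names of the variables that are not clocks -/
  Data : Type
  /-- domain of a non-clock variable -/
  dom : Data → Type
  /-- names of timed automata -/
  Name : Type
  /-- set of locations of the automaton with a given name -/
  Loc : Name → Type
  /-- the set `Δ` of broadcast channels -/
  Bcast : Type
  /-- the set `𝒞` of binary channels -/
  Bin : Type

/-- The typed variables. Besides clocks and other variables there is, for every automaton name `k`,
the variable `loc k` that holds the current location of the automaton called `k`. -/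
inductive Var (σ : Sig) where
  | clock (x : σ.Clock)
  | data (y : σ.Data)
  | loc (k : σ.Name)

/-- The domain of a variable; clocks range over the non-negative reals. -/
def Var.Dom {σ : Sig} : Var σ → Type
  | .clock _ => ℝ≥0
  | .data y => σ.dom y
  | .loc k => σ.Loc k

/-- The set `𝒳` of clocks. -/
def clocks (σ : Sig) : Set (Var σ) := {x | ∃ c, x = .clock c}

/-- Partial functions that assign to some variables a value in their domain. -/
abbrev PVal (σ : Sig) : Type := (x : Var σ) → Option x.Dom

namespace PVal

variable {σ : Sig}

/-- The domain of definition of a partial function. -/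
def dom (f : PVal σ) : Set (Var σ) := {x | (f x).isSome}

/-- The restriction of `f` to `X`. -/
noncomputable def restrict (f : PVal σ) (X : Set (Var σ)) : PVal σ := fun x =>
  open scoped Classical in if x ∈ X then f x else none

/-- The override `f ▷ g`: defined on `dom f ∪ dom g`, with the values of `f` taking precedence. For
compatible `f` and `g` this is the merge `f ‖ g`. -/
def override (f g : PVal σ) : PVal σ := fun x => (f x).or (g x)

/-- `f` and `g` are compatible if they agree on `dom f ∩ dom g`. -/
def Compat (f g : PVal σ) : Prop := ∀ x ∈ f.dom ∩ g.dom, f x = g x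

/-- The update `f[g]`: the override `g ▷ f` restricted to `dom f`. -/
noncomputable def update (f g : PVal σ) : PVal σ := (g.override f).restrict f.dom

/-- `f ⊕ d`: all clocks advance by `d`, the other variables keep their value. -/
def delay (f : PVal σ) (d : ℝ≥0) : PVal σ
  | .clock c => (f (.clock c)).map fun q : ℝ≥0 => q + d
  | .data y => f (.data y)
  | .loc k => f (.loc k)

/-- The nowhere defined function. -/
def empty : PVal σ := fun _ => none

/-- The function `{loc k ↦ l}`. -/
noncomputable def single (k : σ.Name) (l : σ.Loc k) : PVal σ :=
  open scoped Classical in Function.update (empty : PVal σ) (.loc k) (some l)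

end PVal

/-- The set `Val(V)` of valuations of `V`. -/
def Val {σ : Sig} (V : Set (Var σ)) : Set (PVal σ) := {f | f.dom = V}

/-- A property `P` over `V` holds in a valuation `v` of a superset of `V`. -/
def Holds {σ : Sig} (V : Set (Var σ)) (P : Set (PVal σ)) (v : PVal σ) : Prop :=
  v.restrict V ∈ P

/-- The property `P` over `V` is left-closed. -/
def LeftClosed {σ : Sig} (V : Set (Var σ)) (P : Set (PVal σ)) : Prop :=
  ∀ v ∈ Val V, ∀ d : ℝ≥0, v.delay d ∈ P → v ∈ P

/-- The property `P` over `V` does not depend on `W`. -/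
def NotDepend {σ : Sig} (V W : Set (Var σ)) (P : Set (PVal σ)) : Prop :=
  ∀ v ∈ Val V, ∀ u ∈ Val W, v ∈ P ↔ v.update u ∈ P

/-- The comparison operators for clock conditions. -/
inductive Cmp where
  | lt | le | eq | ge | gt

/-- The relation on the reals denoted by a comparison operator. -/
def Cmp.Rel : Cmp → ℝ → ℝ → Prop
  | .lt, a, b => a < b
  | .le, a, b => a ≤ b
  | .eq, a, b => a = b
  | .ge, a, b => a ≥ b
  | .gt, a, b => a > b

/-- Guards over `V`: conjunctions of comparisons of a clock, or of the difference of two clocks, with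
a constant, and of conditions that do not involve clocks. -/
inductive IsGuard {σ : Sig} (V : Set (Var σ)) : Set (PVal σ) → Prop
  | bound (x : σ.Clock) (hx : .clock x ∈ V) (r : Cmp) (n : ℝ) :
      IsGuard V {v | ∃ a : ℝ≥0, v (.clock x) = some a ∧ r.Rel a n}
  | diff (x y : σ.Clock) (hx : .clock x ∈ V) (hy : .clock y ∈ V) (r : Cmp) (n : ℝ) :
      IsGuard V {v | ∃ a b : ℝ≥0, v (.clock x) = some a ∧ v (.clock y) = some b ∧
        r.Rel ((a : ℝ) - b) n}
  | bool (g : Set (PVal σ)) (hg : NotDepend V (V ∩ clocks σ) g) : IsGuard V g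
  | and (g h : Set (PVal σ)) (hg : IsGuard V g) (hh : IsGuard V h) : IsGuard V (g ∩ h)

/-- The actions of transitions of automata: `δ!`, `δ?`, `c!`, `c?` and `τ`. -/
inductive DAct (σ : Sig) where
  | bsend (δ : σ.Bcast)
  | brecv (δ : σ.Bcast)
  | send (c : σ.Bin)
  | recv (c : σ.Bin)
  | tau

/-- The action set `Act`: discrete actions and time-passage actions. -/
inductive Act (σ : Sig) where
  | disc (a : DAct σ)
  | time (d : ℝ≥0)

/-- A transition `l --g,a,ρ--> l'` of an automaton called `k`. -/
structure Edge (σ : Sig) (k : σ.Name) where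
  /-- the source -/
  src : σ.Loc k
  /-- the guard -/
  guard : Set (PVal σ)
  /-- the action -/
  act : DAct σ
  /-- the update function -/
  upd : PVal σ → PVal σ
  /-- the target -/
  tgt : σ.Loc k

/-- A timed automaton called `k`. -/
structure TA (σ : Sig) (k : σ.Name) where
  /-- the committed locations -/
  K : Set (σ.Loc k)
  /-- the initial location -/
  l0 : σ.Loc k
  /-- the external variables -/
  E : Set (Var σ)
  /-- the internal variables -/
  H : Set (Var σ)
  disjoint : Disjoint E H
  /-- the variables `loc` are fresh -/
  fresh : ∀ j, Var.loc j ∉ E ∪ H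
  /-- the initial valuation -/
  v0 : PVal σ
  v0_mem : v0 ∈ Val (E ∪ H)
  /-- the location invariants -/
  I : σ.Loc k → Set (PVal σ)
  inv_leftClosed : ∀ l, LeftClosed (E ∪ H) (I l)
  inv_init : v0 ∈ I l0
  /-- the transitions -/
  edges : Set (Edge σ k)
  isGuard : ∀ e ∈ edges, IsGuard (E ∪ H) e.guard
  upd_mem : ∀ e ∈ edges, ∀ v ∈ Val (E ∪ H), e.upd v ∈ Val (E ∪ H)
  /-- the urgent transitions -/
  urgent : Set (Edge σ k)
  urgent_sub : urgent ⊆ edges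

namespace TA

variable {σ : Sig} {k : σ.Name}

/-- All variables of an automaton (without its location). -/
def V (A : TA σ k) : Set (Var σ) := A.E ∪ A.H

/-- The axioms that are imposed on timed automata to obtain a compositional semantics. -/
structure Axioms (A : TA σ k) : Prop where
  /-- invariants do not depend on external variables -/
  inv_ext : ∀ l, NotDepend A.V A.E (A.I l)
  /-- guards of input transitions do not depend on external variables -/
  input_guard : ∀ e ∈ A.edges, ((∃ δ, e.act = .brecv δ) ∨ ∃ c, e.act = .recv c) →
    NotDepend A.V A.E e.guard
  /-- committed locations can be left -/
  committed : ∀ l ∈ A.K, ∀ v ∈ Val A.V, v ∈ A.I l →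
    ∃ e ∈ A.edges, e.src = l ∧ v ∈ e.guard ∧ e.upd v ∈ A.I e.tgt
  /-- urgent transitions are internal and have no clock guards -/
  urgent : ∀ e ∈ A.urgent, e.act = .tau ∧ NotDepend A.V (A.V ∩ clocks σ) e.guard
  /-- receiving a broadcast does not update external variables -/
  brecv_upd : ∀ e ∈ A.edges, (∃ δ, e.act = .brecv δ) →
    ∀ v ∈ Val A.V, (e.upd v).restrict A.E = v.restrict A.E

/-- Two automata are compatible. -/
def Compatible {k' : σ.Name} (A : TA σ k) (B : TA σ k') : Prop :=
  A.H ∩ B.V = ∅ ∧ B.H ∩ A.V = ∅ ∧ A.v0.Compat B.v0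

/-- The effect of the transition `e` on a state `s`, that is `s[ρ(s⌈V)][{loc ↦ l'}]`. -/
noncomputable def apply (A : TA σ k) (e : Edge σ k) (s : PVal σ) : PVal σ :=
  (s.update (e.upd (s.restrict A.V))).update (PVal.single k e.tgt)

/-- The automaton is in the source of `e`, and the guard of `e` holds. -/
def Enabled (A : TA σ k) (e : Edge σ k) (s : PVal σ) : Prop :=
  s (.loc k) = some e.src ∧ Holds A.V e.guard s

/-- The automaton is in a committed location in the state `s`. -/
def Committed (A : TA σ k) (s : PVal σ) : Prop := ∃ l ∈ A.K, s (.loc k) = some l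

/-- An urgent transition is enabled in the state `s`. -/
def UrgentEnabled (A : TA σ k) (s : PVal σ) : Prop := ∃ e ∈ A.urgent, A.Enabled e s

/-- The invariant of the current location holds in the state `s`. -/
def InvHolds (A : TA σ k) (s : PVal σ) : Prop :=
  ∃ l, s (.loc k) = some l ∧ Holds A.V (A.I l) s

end TA

/-- A labelled transition system over the action set `Act`. -/
structure LTS (σ : Sig) where
  /-- the states -/
  S : Set (PVal σ)
  /-- the initial state -/
  s0 : PVal σ
  /-- the transition relation -/
  Tr : PVal σ → Act σ → PVal σ → Prop

/-- `s` is reachable from the initial state by finitely many transitions. -/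
def LTS.Reachable {σ : Sig} (L : LTS σ) (s : PVal σ) : Prop :=
  Relation.ReflTransGen (fun r t => ∃ a, L.Tr r a t) L.s0 s

/-! ### Networks of timed automata

`A` assigns to every name an automaton; the network `⟨A k₁, …, A kₙ⟩` is given by the list
`[k₁, …, kₙ]` of names. -/

section Network

variable {σ : Sig} (A : (k : σ.Name) → TA σ k)

/-- The listed automata form a network: they are pairwise compatible, and have different names, so
that their location variables are different. -/
def IsNTA (N : List σ.Name) : Prop :=
  N.Nodup ∧ ∀ k ∈ N, ∀ j ∈ N, k ≠ j → (A k).Compatible (A j)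

/-- The union of the sets `V_k ∪ {loc k}`, for the listed automata. -/
def netVars (N : List σ.Name) : Set (Var σ) := {x | ∃ k ∈ N, x ∈ (A k).V ∨ x = .loc k}

/-- The merge of the initial valuations and initial locations of the listed automata. -/
noncomputable def netInit (N : List σ.Name) : PVal σ :=
  (N.foldr (fun k f => (A k).v0.override f) PVal.empty).override
    (N.foldr (fun k f => (PVal.single k (A k).l0).override f) PVal.empty)

/-- The states of the network. -/
def netStates (N : List σ.Name) : Set (PVal σ) :=
  {s | s ∈ Val (netVars A N) ∧ ∀ k ∈ N, (A k).InvHolds s}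

/-- The names of the automata, other than the sender `i`, that can receive on `δ` in `s`. -/
def RS (N : List σ.Name) (δ : σ.Bcast) (i : σ.Name) (s : PVal σ) : Set σ.Name :=
  {j | j ∈ N ∧ j ≠ i ∧ ∃ e ∈ (A j).edges, e.act = .brecv δ ∧ (A j).Enabled e s}

/-- The state after a broadcast by `i` along `e`: first the sender is updated, then the receivers, in
the order of the network, where `f j` is the transition taken by the receiver `j`. -/
noncomputable def bcastTarget (N : List σ.Name) (δ : σ.Bcast) (i : σ.Name) (e : Edge σ i)
    (f : (j : σ.Name) → Edge σ j) (s : PVal σ) : PVal σ :=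
  open scoped Classical in
  (N.filter fun j => j ∈ RS A N δ i s).foldl (fun t j => (A j).apply (f j) t) ((A i).apply e s)

/-- The rules for the transitions of the non-compositional semantics. -/
inductive NetRule (N : List σ.Name) : PVal σ → Act σ → PVal σ → Prop
  | tau (s : PVal σ) (i : σ.Name) (e : Edge σ i) (hi : i ∈ N) (he : e ∈ (A i).edges)
      (ha : e.act = .tau) (hs : (A i).Enabled e s)
      (hc : (∀ q ∈ N, ¬ (A q).Committed s) ∨ e.src ∈ (A i).K) :
      NetRule N s (.disc .tau) ((A i).apply e s)
  | sync (s : PVal σ) (c : σ.Bin) (i j : σ.Name) (e : Edge σ i) (f : Edge σ j)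
      (hi : i ∈ N) (hj : j ∈ N) (hij : i ≠ j)
      (he : e ∈ (A i).edges) (hae : e.act = .send c) (hse : (A i).Enabled e s)
      (hf : f ∈ (A j).edges) (haf : f.act = .recv c) (hsf : (A j).Enabled f s)
      (hc : (∀ q ∈ N, ¬ (A q).Committed s) ∨ e.src ∈ (A i).K ∨ f.src ∈ (A j).K) :
      NetRule N s (.disc .tau) ((A j).apply f ((A i).apply e s))
  | bcst (s : PVal σ) (δ : σ.Bcast) (i : σ.Name) (e : Edge σ i) (f : (j : σ.Name) → Edge σ j)
      (hi : i ∈ N) (he : e ∈ (A i).edges) (hae : e.act = .bsend δ) (hse : (A i).Enabled e s)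
      (hf : ∀ j ∈ RS A N δ i s, f j ∈ (A j).edges ∧ (f j).act = .brecv δ ∧ (A j).Enabled (f j) s)
      (hc : (∀ q ∈ N, ¬ (A q).Committed s) ∨ e.src ∈ (A i).K ∨
        ∃ j ∈ RS A N δ i s, (f j).src ∈ (A j).K) :
      NetRule N s (.disc .tau) (bcastTarget A N δ i e f s)
  | time (s : PVal σ) (d : ℝ≥0) (hc : ∀ q ∈ N, ¬ (A q).Committed s)
      (hu : ∀ q ∈ N, ¬ (A q).UrgentEnabled s) :
      NetRule N s (.time d) (s.delay d)

/-- The (non-compositional) LTS semantics of a network. -/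
noncomputable def netLTS (N : List σ.Name) : LTS σ where
  S := netStates A N
  s0 := netInit A N
  Tr s a t := s ∈ netStates A N ∧ t ∈ netStates A N ∧ NetRule A N s a t

/-- The property `P` over `V` is a safety property of the network: `N ⊨ ∀□P`. -/
def IsSafety (N : List σ.Name) (V : Set (Var σ)) (P : Set (PVal σ)) : Prop :=
  ∀ s, (netLTS A N).Reachable s → Holds V P s

end Network

/-! ### Timed transition systems with broadcast actions -/

/-- The tuple `⟨E, H, S, s⁰, Act, →¹, →⁰⟩` of a timed transition system with broadcast actions. The
transition `s --a,b--> t` is written `Tr s a b t`; it is committed if `b = true`. -/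
structure TTSB (σ : Sig) where
  /-- the external variables -/
  E : Set (Var σ)
  /-- the internal variables -/
  H : Set (Var σ)
  /-- the states -/
  S : Set (PVal σ)
  /-- the initial state -/
  s0 : PVal σ
  /-- the transitions -/
  Tr : PVal σ → Act σ → Bool → PVal σ → Prop

/-- The rules for the TTSB of a timed automaton: transitions of the automaton, passage of time, and
an uncommitted self-loop for each broadcast that the automaton does not receive. -/
inductive TARule {σ : Sig} {k : σ.Name} (A : TA σ k) : PVal σ → Act σ → Bool → PVal σ → Prop
  | act (s : PVal σ) (e : Edge σ k) (b : Bool) (he : e ∈ A.edges) (hs : A.Enabled e s)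
      (hb : b = true ↔ e.src ∈ A.K) : TARule A s (.disc e.act) b (A.apply e s)
  | time (s : PVal σ) (d : ℝ≥0) (hc : ¬ A.Committed s) (hu : ¬ A.UrgentEnabled s) :
      TARule A s (.time d) false (s.delay d)
  | virt (s : PVal σ) (δ : σ.Bcast)
      (h : ∀ e ∈ A.edges, e.act = .brecv δ → ¬ A.Enabled e s) :
      TARule A s (.disc (.brecv δ)) false s

/-- The TTSB semantics of a timed automaton. -/
noncomputable def TA.toTTSB {σ : Sig} {k : σ.Name} (A : TA σ k) : TTSB σ where
  E := A.E
  H := A.H ∪ {.loc k}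
  S := {s | s ∈ Val (A.E ∪ A.H ∪ {.loc k}) ∧ A.InvHolds s}
  s0 := A.v0.override (.single k A.l0)
  Tr s a b t := (s ∈ Val (A.E ∪ A.H ∪ {.loc k}) ∧ A.InvHolds s) ∧
    (t ∈ Val (A.E ∪ A.H ∪ {.loc k}) ∧ A.InvHolds t) ∧ TARule A s a b t

namespace TTSB

variable {σ : Sig}

/-- The state `s` has an outgoing committed transition. -/
def Comm (T : TTSB σ) (s : PVal σ) : Prop := ∃ a t, T.Tr s a true t

/-- The rules for parallel composition in which `T₁` contributes the states `r`, `r'` and `T₂` the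
states `s`, `s'`. -/
inductive ParRule (T₁ T₂ : TTSB σ) : PVal σ → Act σ → Bool → PVal σ → Prop
  | send (r s r' : PVal σ) (c : σ.Bin) (b : Bool) (hr : r ∈ T₁.S) (hs : s ∈ T₂.S)
      (hrs : r.Compat s) (h : T₁.Tr r (.disc (.send c)) b r') :
      ParRule T₁ T₂ (r.override s) (.disc (.send c)) b (r'.override s)
  | recv (r s r' : PVal σ) (c : σ.Bin) (b : Bool) (hr : r ∈ T₁.S) (hs : s ∈ T₂.S)
      (hrs : r.Compat s) (h : T₁.Tr r (.disc (.recv c)) b r') :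
      ParRule T₁ T₂ (r.override s) (.disc (.recv c)) b (r'.override s)
  | tau (r s r' : PVal σ) (b : Bool) (hr : r ∈ T₁.S) (hs : s ∈ T₂.S) (hrs : r.Compat s)
      (h : T₁.Tr r (.disc .tau) b r') (hc : T₂.Comm s → b = true) :
      ParRule T₁ T₂ (r.override s) (.disc .tau) b (r'.override s)
  | sync (r s r' s' : PVal σ) (c : σ.Bin) (b b' : Bool) (hr : r ∈ T₁.S) (hs : s ∈ T₂.S)
      (hrs : r.Compat s) (h : T₁.Tr r (.disc (.send c)) b r')
      (h' : T₂.Tr (s.update r') (.disc (.recv c)) b' s')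
      (hc : T₁.Comm r ∨ T₂.Comm s → (b || b') = true) :
      ParRule T₁ T₂ (r.override s) (.disc .tau) (b || b') (s'.override r')
  | snd (r s r' s' : PVal σ) (δ : σ.Bcast) (b b' : Bool) (hr : r ∈ T₁.S) (hs : s ∈ T₂.S)
      (hrs : r.Compat s) (h : T₁.Tr r (.disc (.bsend δ)) b r')
      (h' : T₂.Tr (s.update r') (.disc (.brecv δ)) b' s') :
      ParRule T₁ T₂ (r.override s) (.disc (.bsend δ)) (b || b') (r'.override s')
  | rcv (r s r' s' : PVal σ) (δ : σ.Bcast) (b b' : Bool) (hr : r ∈ T₁.S) (hs : s ∈ T₂.S)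
      (hrs : r.Compat s) (h : T₁.Tr r (.disc (.brecv δ)) b r')
      (h' : T₂.Tr s (.disc (.brecv δ)) b' s') :
      ParRule T₁ T₂ (r.override s) (.disc (.brecv δ)) (b || b') (r'.override s')
  | time (r s r' s' : PVal σ) (d : ℝ≥0) (hr : r ∈ T₁.S) (hs : s ∈ T₂.S) (hrs : r.Compat s)
      (h : T₁.Tr r (.time d) false r') (h' : T₂.Tr s (.time d) false s') :
      ParRule T₁ T₂ (r.override s) (.time d) false (r'.override s')

/-- The parallel composition `T₁ ‖ T₂`; each rule is used with both orders of the components. -/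
def par (T₁ T₂ : TTSB σ) : TTSB σ where
  E := T₁.E ∪ T₂.E
  H := T₁.H ∪ T₂.H
  S := {q | ∃ r ∈ T₁.S, ∃ s ∈ T₂.S, r.Compat s ∧ q = r.override s}
  s0 := T₁.s0.override T₂.s0
  Tr q a b q' := ParRule T₁ T₂ q a b q' ∨ ParRule T₂ T₁ q a b q'

/-- The actions `δ?`, `c!`, `c?` on channels in `C`. -/
def removed (C : Set (σ.Bcast ⊕ σ.Bin)) : Set (Act σ) :=
  {a | (∃ δ, .inl δ ∈ C ∧ a = .disc (.brecv δ)) ∨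
    ∃ c, .inr c ∈ C ∧ (a = .disc (.send c) ∨ a = .disc (.recv c))}

/-- The actions `δ!` on broadcast channels in `C`. -/
def hidden (C : Set (σ.Bcast ⊕ σ.Bin)) : Set (Act σ) :=
  {a | ∃ δ, .inl δ ∈ C ∧ a = .disc (.bsend δ)}

/-- The restriction of `T` by the channels in `C` and the external variables in `X`. -/
def restrict (T : TTSB σ) (C : Set (σ.Bcast ⊕ σ.Bin)) (X : Set (Var σ)) : TTSB σ where
  E := T.E \ X
  H := T.H ∪ (T.E ∩ X)
  S := T.S
  s0 := T.s0
  Tr s a b t := (T.Tr s a b t ∧ a ∉ removed C ∧ a ∉ hidden C) ∨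
    (a = .disc .tau ∧ (T.Comm s → b = true) ∧ ∃ a' ∈ hidden C, T.Tr s a' b t)

/-- The channels that are used by `T`. A binary channel is used if it labels a transition. A
broadcast channel `δ` is unused if there is no `δ!`-transition, and the `δ?`-transitions are exactly
the uncommitted self-loops at all states (by which `T` ignores broadcasts on `δ`). -/
def used (T : TTSB σ) : Set (σ.Bcast ⊕ σ.Bin) :=
  {x | match x with
    | .inl δ => ¬ ((∀ s b t, ¬ T.Tr s (.disc (.bsend δ)) b t) ∧
        ∀ s ∈ T.S, ∀ b t, T.Tr s (.disc (.brecv δ)) b t ↔ b = false ∧ t = s)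
    | .inr c => ∃ s b t, T.Tr s (.disc (.send c)) b t ∨ T.Tr s (.disc (.recv c)) b t}

/-- `R` is a timed step simulation from `T₁` to `T₂`. -/
structure IsTimedStepSimulation (T₁ T₂ : TTSB σ) (R : PVal σ → PVal σ → Prop) : Prop where
  subset : ∀ r s, R r s → r ∈ T₁.S ∧ s ∈ T₂.S
  init : R T₁.s0 T₂.s0
  ext : ∀ r s, R r s → r.restrict T₁.E = s.restrict T₂.E
  upd : ∀ r s, R r s → ∀ u ∈ Val T₁.E, R (r.update u) (s.update u)
  comm : ∀ r s, R r s → T₂.Comm s → T₁.Comm r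
  step : ∀ r s, R r s → ∀ a b r', T₁.Tr r a b r' →
    (∃ s', T₂.Tr s a b s' ∧ R r' s') ∨ (a = .disc .tau ∧ R r' s)

/-- `T₁` and `T₂` are comparable. -/
def Comparable (T₁ T₂ : TTSB σ) : Prop := T₁.E = T₂.E

/-- `T₁ ⪯ T₂`: there is a timed step simulation from `T₁` to `T₂`. -/
def Le (T₁ T₂ : TTSB σ) : Prop := ∃ R, IsTimedStepSimulation T₁ T₂ R

/-- The side condition for restricting `T` by the channels in `C`: every committed state has an
outgoing committed transition whose action is not removed. -/
def SideCondition (T : TTSB σ) (C : Set (σ.Bcast ⊕ σ.Bin)) : Prop :=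
  ∀ r ∈ T.S, T.Comm r → ∃ a, a ∉ removed C ∧ ∃ r', T.Tr r a true r'

end TTSB

/-- The parallel composition `TTSB(A k₁) ‖ ⋯ ‖ TTSB(A kₙ)` for a non-empty list `[k₁, …, kₙ]` (for
the empty list, which is never used, a system without states). -/
noncomputable def netTTSB {σ : Sig} (A : (k : σ.Name) → TA σ k) : List σ.Name → TTSB σ
  | [] => ⟨∅, ∅, ∅, .empty, fun _ _ _ _ => False⟩
  | k :: N => N.foldl (fun T j => T.par (A j).toTTSB) (A k).toTTSB

/-- The external variables of the automata listed in `M` that are not among the variables of the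
automata listed in `N`. -/
def localExt {σ : Sig} (A : (k : σ.Name) → TA σ k) (M N : List σ.Name) : Set (Var σ) :=
  {x | ∃ k ∈ M, x ∈ (A k).E} \ netVars A N

/-! The proof is a simulation between the two networks. A state of the concrete network is matched
with a state of the abstract one if they agree on all variables of the common automata and their
remaining parts are related by the given timed step simulation `R` (this is `Related`). The initial
states match, every concrete step is answered by at most one abstract step (`Abstraction.step`), and
a property of the common variables cannot tell matched states apart.

To connect the network semantics with the compositional one, both are expressed through `Flat`, the
joint discrete moves of a list of automata in any valuation that contains their variables, without
invariants and commitment priorities. `Represents` says that a TTSB has exactly these moves between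
legal states, except that an uncommitted τ may be missing while some automaton is in a committed
location. This slack makes the notion stable under composition (`Represents.par`): a committed
transition forces a committed location, and the converse is never needed. Three facts carry the
argument. Input guards and invariants see only internal variables, so a move of one group does not
affect the inputs available to another group, nor its invariants. Receiving a broadcast writes only
internal variables, so the order of the receivers is irrelevant (`Rcv.perm`). A joint move splits
into a move of the initiating group and an answer of the other one, through a legal intermediate
state (`Flat.dec`, `Flat.mid_mem_netStates`).

The two halves of a step are then matched separately. Moves of the common automata are copied, and
`R` survives because it is closed under updates of the external variables (`step_common`). Moves of
the other automata are answered through `R` (`step_abstract`). All channels used by the common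
automata lie in Σ, so a synchronisation between the groups stays visible to `R`, whereas a broadcast
outside Σ is ignored by the common automata and acts like τ. Answers carry the same commitment flag,
so an uncommitted step only needs that the abstract network has no committed location when the
concrete one has none (`related_not_committed`). -/

namespace PVal

/-! ### Calculus of partial valuations: restriction, override, update, delay. -/

variable {σ : Sig}

theorem mem_dom {f : PVal σ} {x : Var σ} : x ∈ f.dom ↔ f x ≠ none := by
  simp [dom, Option.isSome_iff_ne_none]

theorem notMem_dom {f : PVal σ} {x : Var σ} : x ∉ f.dom ↔ f x = none := by
  simp [mem_dom]

theorem mem_dom_congr {f g : PVal σ} {x : Var σ} (h : f x = g x) : x ∈ f.dom ↔ x ∈ g.dom := by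
  simp [mem_dom, h]

theorem restrict_of_mem (f : PVal σ) {X : Set (Var σ)} {x : Var σ} (h : x ∈ X) :
    f.restrict X x = f x := by simp [restrict, h]

theorem restrict_of_notMem (f : PVal σ) {X : Set (Var σ)} {x : Var σ} (h : x ∉ X) :
    f.restrict X x = none := by simp [restrict, h]

theorem dom_restrict (f : PVal σ) (X : Set (Var σ)) : (f.restrict X).dom = f.dom ∩ X := by
  ext x
  by_cases h : x ∈ X <;> simp [mem_dom, restrict, h]

theorem restrict_mem_Val {f : PVal σ} {X : Set (Var σ)} (h : X ⊆ f.dom) :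
    f.restrict X ∈ Val X := by
  change (f.restrict X).dom = X
  rw [dom_restrict]
  exact Set.inter_eq_right.2 h

theorem restrict_eq_restrict_iff {f g : PVal σ} {X : Set (Var σ)} :
    f.restrict X = g.restrict X ↔ ∀ x ∈ X, f x = g x := by
  constructor
  · intro h x hx
    rw [← restrict_of_mem f hx, h, restrict_of_mem g hx]
  · intro h
    funext x
    by_cases hx : x ∈ X
    · rw [restrict_of_mem f hx, restrict_of_mem g hx, h x hx]
    · rw [restrict_of_notMem f hx, restrict_of_notMem g hx]

theorem restrict_eq_self {f : PVal σ} {X : Set (Var σ)} (h : f.dom ⊆ X) : f.restrict X = f := by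
  funext x
  by_cases hx : x ∈ X
  · rw [restrict_of_mem f hx]
  · rw [restrict_of_notMem f hx, notMem_dom.1 fun h' => hx (h h')]

theorem override_of_mem {f : PVal σ} (g : PVal σ) {x : Var σ} (h : x ∈ f.dom) :
    f.override g x = f x := by
  obtain ⟨a, ha⟩ := Option.ne_none_iff_exists'.1 (mem_dom.1 h)
  simp [override, ha]

theorem override_of_notMem {f : PVal σ} (g : PVal σ) {x : Var σ} (h : x ∉ f.dom) :
    f.override g x = g x := by
  simp [override, notMem_dom.1 h]

theorem dom_override (f g : PVal σ) : (f.override g).dom = f.dom ∪ g.dom := by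
  ext x
  by_cases h : x ∈ f.dom
  · rw [mem_dom_congr (override_of_mem g h)]; simp [h]
  · rw [mem_dom_congr (override_of_notMem g h)]; simp [h]

theorem override_eq_right {f g : PVal σ} (h : f.Compat g) {x : Var σ} (hx : x ∈ g.dom) :
    f.override g x = g x := by
  by_cases hf : x ∈ f.dom
  · rw [override_of_mem g hf, h x ⟨hf, hx⟩]
  · rw [override_of_notMem g hf]

theorem dom_update (f g : PVal σ) : (f.update g).dom = f.dom := by
  rw [update, dom_restrict, dom_override]
  exact Set.inter_eq_right.2 Set.subset_union_right

theorem update_of_mem {f g : PVal σ} {x : Var σ} (hf : x ∈ f.dom) (hg : x ∈ g.dom) :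
    f.update g x = g x := by
  rw [update, restrict_of_mem _ hf, override_of_mem _ hg]

theorem update_of_notMem {f g : PVal σ} {x : Var σ} (hg : x ∉ g.dom) :
    f.update g x = f x := by
  by_cases hf : x ∈ f.dom
  · rw [update, restrict_of_mem _ hf, override_of_notMem _ hg]
  · rw [update, restrict_of_notMem _ hf, notMem_dom.1 hf]

theorem single_self (k : σ.Name) (l : σ.Loc k) : single k l (.loc k) = some l := by
  classical exact Function.update_self _ _ _

theorem single_of_ne {k : σ.Name} (l : σ.Loc k) {x : Var σ} (h : x ≠ .loc k) :
    single k l x = none := by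
  classical
  rw [single, Function.update_of_ne h, empty]

theorem dom_single (k : σ.Name) (l : σ.Loc k) : (single k l).dom = {.loc k} := by
  ext x
  by_cases h : x = .loc k
  · subst h
    rw [mem_dom, single_self]
    exact ⟨fun _ => rfl, fun _ => Option.some_ne_none _⟩
  · simp [mem_dom, single_of_ne l h, h]

/-- The valuation that equals `f` on `W` and `g` elsewhere. -/
noncomputable def splice (W : Set (Var σ)) (f g : PVal σ) : PVal σ := fun x =>
  open scoped Classical in if x ∈ W then f x else g x

theorem splice_of_mem {W : Set (Var σ)} (f g : PVal σ) {x : Var σ} (h : x ∈ W) :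
    splice W f g x = f x := by simp [splice, h]

theorem splice_of_notMem {W : Set (Var σ)} (f g : PVal σ) {x : Var σ} (h : x ∉ W) :
    splice W f g x = g x := by simp [splice, h]

theorem delay_zero (f : PVal σ) : f.delay 0 = f := by
  funext x
  cases x with
  | clock c =>
    change (f (.clock c)).map (fun q : ℝ≥0 => q + 0) = _
    simp only [add_zero]
    exact Option.map_id'
  | data y => rfl
  | loc k => rfl

theorem dom_delay (f : PVal σ) (d : ℝ≥0) : (f.delay d).dom = f.dom := by
  ext x
  cases x with
  | clock c => exact (mem_dom.trans (not_congr Option.map_eq_none_iff)).trans mem_dom.symm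
  | data y => rfl
  | loc k => rfl

theorem delay_congr {f g : PVal σ} {x : Var σ} (h : f x = g x) (d : ℝ≥0) :
    f.delay d x = g.delay d x := by
  cases x <;> simp_all [delay]

theorem delay_restrict (f : PVal σ) (X : Set (Var σ)) (d : ℝ≥0) :
    (f.restrict X).delay d = (f.delay d).restrict X := by
  funext x
  by_cases hx : x ∈ X
  · rw [restrict_of_mem _ hx, delay_congr (restrict_of_mem f hx)]
  · rw [restrict_of_notMem _ hx, ← notMem_dom, dom_delay, notMem_dom, restrict_of_notMem _ hx]

end PVal

open PVal

/-! ### Which variables a single automaton reads and writes. -/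

theorem Holds.congr {σ : Sig} {V : Set (Var σ)} {P : Set (PVal σ)} {q p : PVal σ}
    (h : ∀ x ∈ V, q x = p x) : Holds V P q ↔ Holds V P p := by
  rw [Holds, Holds, restrict_eq_restrict_iff.2 h]

/-- Overwriting the `E`-part of `q` by that of `p` turns the restriction of `q` into that of `p`,
and by independence such an update does not affect `P`. -/
theorem NotDepend.holds_congr {σ : Sig} {E H : Set (Var σ)} {P : Set (PVal σ)}
    (hP : NotDepend (E ∪ H) E P) {q p : PVal σ} (hq : E ∪ H ⊆ q.dom) (hp : E ∪ H ⊆ p.dom)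
    (h : ∀ x ∈ H, q x = p x) : Holds (E ∪ H) P q ↔ Holds (E ∪ H) P p := by
  have hE : E ⊆ p.dom := fun x hx => hp (Or.inl hx)
  have key : (q.restrict (E ∪ H)).update (p.restrict E) = p.restrict (E ∪ H) := by
    funext x
    by_cases hx : x ∈ E
    · have hx' : x ∈ E ∪ H := Or.inl hx
      rw [update_of_mem, restrict_of_mem _ hx, restrict_of_mem _ hx']
      · rw [dom_restrict]; exact ⟨hq hx', hx'⟩
      · rw [dom_restrict]; exact ⟨hE hx, hx⟩
    · rw [update_of_notMem (by rw [dom_restrict]; exact fun h => hx h.2)]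
      by_cases hx' : x ∈ E ∪ H
      · rw [restrict_of_mem _ hx', restrict_of_mem _ hx', h x (hx'.resolve_left hx)]
      · rw [restrict_of_notMem _ hx', restrict_of_notMem _ hx']
  rw [Holds, Holds, hP _ (restrict_mem_Val hq) _ (restrict_mem_Val hE), key]

namespace TA

variable {σ : Sig} {k : σ.Name} (A : TA σ k)

/-- The variables of an automaton, including its location variable. -/
def vars : Set (Var σ) := A.V ∪ {.loc k}

/-- The internal variables of an automaton, including its location variable. -/
def own : Set (Var σ) := A.H ∪ {.loc k}

theorem own_subset_vars : A.own ⊆ A.vars := Set.union_subset_union_left _ Set.subset_union_right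

theorem loc_mem_own : .loc k ∈ A.own := Or.inr rfl

theorem loc_mem_vars : .loc k ∈ A.vars := Or.inr rfl

theorem loc_notMem_V (j : σ.Name) : .loc j ∉ A.V := A.fresh j

variable {A}

theorem V_subset_dom {q : PVal σ} (hq : A.vars ⊆ q.dom) : A.V ⊆ q.dom :=
  fun _ hx => hq (Or.inl hx)

theorem dom_apply (e : Edge σ k) (q : PVal σ) : (A.apply e q).dom = q.dom := by
  rw [apply, dom_update, dom_update]

theorem dom_upd {e : Edge σ k} (he : e ∈ A.edges) {q : PVal σ} (hq : A.vars ⊆ q.dom) :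
    (e.upd (q.restrict A.V)).dom = A.V :=
  A.upd_mem e he _ (restrict_mem_Val (V_subset_dom hq))

theorem apply_loc (e : Edge σ k) {q : PVal σ} (hq : A.vars ⊆ q.dom) :
    A.apply e q (.loc k) = some e.tgt := by
  rw [apply, update_of_mem, single_self]
  · rw [dom_update]; exact hq A.loc_mem_vars
  · rw [dom_single]; rfl

theorem apply_of_mem_V {e : Edge σ k} (he : e ∈ A.edges) {q : PVal σ} (hq : A.vars ⊆ q.dom)
    {x : Var σ} (hx : x ∈ A.V) : A.apply e q x = e.upd (q.restrict A.V) x := by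
  rw [apply, update_of_notMem, update_of_mem]
  · exact hq (Or.inl hx)
  · rw [dom_upd he hq]; exact hx
  · rw [dom_single]
    rintro rfl
    exact A.loc_notMem_V k hx

theorem apply_of_notMem_vars {e : Edge σ k} (he : e ∈ A.edges) {q : PVal σ}
    (hq : A.vars ⊆ q.dom) {x : Var σ} (hx : x ∉ A.vars) : A.apply e q x = q x := by
  rw [apply, update_of_notMem, update_of_notMem]
  · rw [dom_upd he hq]; exact fun h => hx (Or.inl h)
  · rw [dom_single]; exact fun h => hx (Or.inr h)

/-- The point `x` need not be a variable of the automaton: elsewhere the transition does nothing.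
This pointwise form serves valuations of any larger set of variables. -/
theorem apply_congr {e : Edge σ k} (he : e ∈ A.edges) {q p : PVal σ} (hq : A.vars ⊆ q.dom)
    (hp : A.vars ⊆ p.dom) (h : ∀ x ∈ A.vars, q x = p x) {x : Var σ} (hx : q x = p x) :
    A.apply e q x = A.apply e p x := by
  by_cases hxV : x ∈ A.V
  · rw [apply_of_mem_V he hq hxV, apply_of_mem_V he hp hxV,
      restrict_eq_restrict_iff.2 fun y hy => h y (Or.inl hy)]
  · by_cases hxl : x = .loc k
    · subst hxl
      rw [apply_loc e hq, apply_loc e hp]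
    · have : x ∉ A.vars := fun h => h.elim hxV hxl
      rw [apply_of_notMem_vars he hq this, apply_of_notMem_vars he hp this, hx]

/-- Receiving a broadcast changes only internal variables. -/
theorem apply_of_notMem_own (hA : A.Axioms) {e : Edge σ k} (he : e ∈ A.edges) {δ : σ.Bcast}
    (ha : e.act = .brecv δ) {q : PVal σ} (hq : A.vars ⊆ q.dom) {x : Var σ} (hx : x ∉ A.own) :
    A.apply e q x = q x := by
  by_cases hxV : x ∈ A.V
  · have hxE : x ∈ A.E := hxV.resolve_right fun h => hx (Or.inl h)
    have h := restrict_eq_restrict_iff.1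
      (hA.brecv_upd e he ⟨δ, ha⟩ _ (restrict_mem_Val (V_subset_dom hq))) x hxE
    rw [apply_of_mem_V he hq hxV, h, restrict_of_mem _ hxV]
  · exact apply_of_notMem_vars he hq fun h => h.elim hxV fun h => hx (Or.inr h)

theorem Enabled.congr {e : Edge σ k} {q p : PVal σ} (h : ∀ x ∈ A.vars, q x = p x) :
    A.Enabled e q ↔ A.Enabled e p := by
  rw [Enabled, Enabled, h _ A.loc_mem_vars, Holds.congr fun x hx => h x (Or.inl hx)]

/-- Enabledness of input transitions does not depend on external variables. -/
theorem Enabled.congr_own (hA : A.Axioms) {e : Edge σ k} (he : e ∈ A.edges)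
    (ha : (∃ δ, e.act = .brecv δ) ∨ ∃ c, e.act = .recv c) {q p : PVal σ}
    (hq : A.vars ⊆ q.dom) (hp : A.vars ⊆ p.dom) (h : ∀ x ∈ A.own, q x = p x) :
    A.Enabled e q ↔ A.Enabled e p := by
  rw [Enabled, Enabled, h _ A.loc_mem_own]
  exact and_congr_right fun _ => (hA.input_guard e he ha).holds_congr (V_subset_dom hq)
    (V_subset_dom hp) fun x hx => h x (Or.inl hx)

/-- By `inv_ext`, other automata may write shared variables without endangering this invariant. The
variant `congr_vars` asks for agreement on all variables, but needs neither axioms nor assumptions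
on domains. -/
theorem InvHolds.congr (hA : A.Axioms) {q p : PVal σ}
    (hq : A.vars ⊆ q.dom) (hp : A.vars ⊆ p.dom) (h : ∀ x ∈ A.own, q x = p x) :
    A.InvHolds q ↔ A.InvHolds p := by
  rw [InvHolds, InvHolds, h _ A.loc_mem_own]
  exact exists_congr fun l => and_congr_right fun _ =>
    (hA.inv_ext l).holds_congr (V_subset_dom hq) (V_subset_dom hp) fun x hx => h x (Or.inl hx)

theorem InvHolds.congr_vars {q p : PVal σ} (h : ∀ x ∈ A.vars, q x = p x) :
    A.InvHolds q ↔ A.InvHolds p := by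
  rw [InvHolds, InvHolds, h _ A.loc_mem_vars]
  exact exists_congr fun l => and_congr_right fun _ => Holds.congr fun x hx => h x (Or.inl hx)

theorem Committed.congr {q p : PVal σ} (h : q (.loc k) = p (.loc k)) :
    A.Committed q ↔ A.Committed p := by
  rw [Committed, Committed, h]

theorem UrgentEnabled.congr {q p : PVal σ} (h : ∀ x ∈ A.vars, q x = p x) :
    A.UrgentEnabled q ↔ A.UrgentEnabled p :=
  exists_congr fun _ => and_congr_right fun _ => Enabled.congr h

theorem Enabled.committed {e : Edge σ k} {q : PVal σ} (h : A.Enabled e q) (hK : e.src ∈ A.K) :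
    A.Committed q := ⟨_, hK, h.1⟩

end TA

theorem loc_mem_vars_iff {σ : Sig} {k j : σ.Name} (A : TA σ k) : .loc j ∈ A.vars ↔ j = k := by
  constructor
  · rintro (h | h)
    · exact absurd h (A.loc_notMem_V j)
    · exact Var.loc.inj h
  · rintro rfl
    exact A.loc_mem_vars

/-! ### Separated lists of automata, and sequential reception of a broadcast. -/

section Flat

variable {σ : Sig} {A : (k : σ.Name) → TA σ k}

theorem mem_netVars {N : List σ.Name} {x : Var σ} :
    x ∈ netVars A N ↔ ∃ k ∈ N, x ∈ (A k).vars := Iff.rfl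

theorem vars_subset_netVars {N : List σ.Name} {k : σ.Name} (hk : k ∈ N) :
    (A k).vars ⊆ netVars A N := fun _ hx => ⟨k, hk, hx⟩

theorem netVars_mono {M N : List σ.Name} (h : M ⊆ N) : netVars A M ⊆ netVars A N :=
  fun _ ⟨k, hk, hx⟩ => ⟨k, h hk, hx⟩

theorem netVars_append (M N : List σ.Name) :
    netVars A (M ++ N) = netVars A M ∪ netVars A N := by
  ext x
  simp only [mem_netVars, List.mem_append, Set.mem_union, or_and_right, exists_or]

theorem netVars_congr {M N : List σ.Name} (h : ∀ k, k ∈ M ↔ k ∈ N) :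
    netVars A M = netVars A N :=
  Set.Subset.antisymm (netVars_mono fun k => (h k).1) (netVars_mono fun k => (h k).2)

variable (A) in
/-- The listed automata are different, satisfy the axioms, and the internal variables of each of
them do not occur in the others. -/
structure Separated (N : List σ.Name) : Prop where
  nodup : N.Nodup
  own : ∀ k ∈ N, ∀ j ∈ N, k ≠ j → ∀ x ∈ (A k).own, x ∉ (A j).vars
  ax : ∀ k ∈ N, (A k).Axioms

theorem IsNTA.separated {N : List σ.Name} (h : IsNTA A N) (hax : ∀ k ∈ N, (A k).Axioms) :
    Separated A N where
  nodup := h.1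
  own k hk j hj hkj x hx hx' := by
    rcases hx with hx | rfl
    · rcases hx' with hx' | rfl
      · have := (h.2 k hk j hj hkj).1
        exact Set.notMem_empty x (this ▸ ⟨hx, hx'⟩)
      · exact (A k).loc_notMem_V j (Or.inr hx)
    · exact hkj ((loc_mem_vars_iff (A j)).1 hx')
  ax := hax

namespace Separated

theorem subperm {M N : List σ.Name} (h : Separated A N) (hM : M.Nodup) (hMN : M ⊆ N) :
    Separated A M :=
  ⟨hM, fun k hk j hj => h.own k (hMN hk) j (hMN hj), fun k hk => h.ax k (hMN hk)⟩

theorem perm {M N : List σ.Name} (h : Separated A N) (hMN : N.Perm M) : Separated A M :=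
  h.subperm (hMN.nodup_iff.1 h.nodup) hMN.symm.subset

theorem left {M N : List σ.Name} (h : Separated A (M ++ N)) : Separated A M :=
  h.subperm h.nodup.of_append_left (List.subset_append_left M N)

theorem right {M N : List σ.Name} (h : Separated A (M ++ N)) : Separated A N :=
  h.subperm h.nodup.of_append_right (List.subset_append_right M N)

theorem swap {M N : List σ.Name} (h : Separated A (M ++ N)) : Separated A (N ++ M) :=
  h.perm List.perm_append_comm

theorem of_cons {k : σ.Name} {N : List σ.Name} (h : Separated A (k :: N)) : Separated A N :=
  h.subperm h.nodup.of_cons (List.subset_cons_self k N)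

theorem own_notMem_left {M N : List σ.Name} (h : Separated A (M ++ N)) {k : σ.Name}
    (hk : k ∈ M) {x : Var σ} (hx : x ∈ (A k).own) : x ∉ netVars A N := by
  rintro ⟨j, hj, hxj⟩
  refine h.own k (List.mem_append_left _ hk) j (List.mem_append_right _ hj) ?_ x hx hxj
  rintro rfl
  exact List.disjoint_of_nodup_append h.nodup hk hj

theorem ne {M N : List σ.Name} (h : Separated A (M ++ N)) {k j : σ.Name}
    (hk : k ∈ M) (hj : j ∈ N) : k ≠ j := by
  rintro rfl
  exact List.disjoint_of_nodup_append h.nodup hk hj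

end Separated

theorem TA.mem_E_of_notMem_own {k : σ.Name} {A : TA σ k} {x : Var σ} (hx : x ∈ A.vars)
    (h : x ∉ A.own) : x ∈ A.E := by
  rcases hx with hx | hx
  · exact hx.resolve_right fun hH => h (Or.inl hH)
  · exact absurd (Or.inr hx) h

variable (A) in
/-- The automaton `k` receives a broadcast on `δ`, or ignores it if it cannot receive. -/
inductive RcvOne (δ : σ.Bcast) (k : σ.Name) : PVal σ → Bool → PVal σ → Prop
  | take (q : PVal σ) (e : Edge σ k) (b : Bool) (he : e ∈ (A k).edges) (ha : e.act = .brecv δ)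
      (hs : (A k).Enabled e q) (hb : b = true ↔ e.src ∈ (A k).K) :
      RcvOne δ k q b ((A k).apply e q)
  | skip (q : PVal σ) (h : ∀ e ∈ (A k).edges, e.act = .brecv δ → ¬ (A k).Enabled e q) :
      RcvOne δ k q false q

variable (A) in
/-- The listed automata receive a broadcast on `δ` one after the other. -/
inductive Rcv (δ : σ.Bcast) : List σ.Name → PVal σ → Bool → PVal σ → Prop
  | nil (q : PVal σ) : Rcv δ [] q false q
  | cons (k : σ.Name) (L : List σ.Name) (q q₁ q' : PVal σ) (b b' : Bool)
      (h : RcvOne A δ k q b q₁) (h' : Rcv δ L q₁ b' q') : Rcv δ (k :: L) q (b || b') q'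

section RcvOne

variable {δ : σ.Bcast} {k : σ.Name} {q q' : PVal σ} {b : Bool}

theorem RcvOne.dom (h : RcvOne A δ k q b q') : q'.dom = q.dom := by
  cases h
  · rw [TA.dom_apply]
  · rfl

theorem RcvOne.frame (h : RcvOne A δ k q b q') (hA : (A k).Axioms) (hq : (A k).vars ⊆ q.dom)
    {x : Var σ} (hx : x ∉ (A k).own) : q' x = q x := by
  cases h with
  | take e _ he ha => exact TA.apply_of_notMem_own hA he ha hq hx
  | skip => rfl

/-- A reception reads only the variables of `k` and writes only its internal ones, so `h₁` and `h₂`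
determine `p'` completely. -/
theorem RcvOne.transfer (h : RcvOne A δ k q b q') (hA : (A k).Axioms) {p p' : PVal σ}
    (hq : (A k).vars ⊆ q.dom) (hp : (A k).vars ⊆ p.dom) (hqp : ∀ x ∈ (A k).vars, q x = p x)
    (h₁ : ∀ x ∈ (A k).own, p' x = q' x) (h₂ : ∀ x ∉ (A k).own, p' x = p x) :
    RcvOne A δ k p b p' := by
  cases h with
  | take e _ he ha hs hb =>
    have : p' = (A k).apply e p := by
      funext x
      by_cases hx : x ∈ (A k).own
      · rw [h₁ x hx, TA.apply_congr he hq hp hqp (hqp x ((A k).own_subset_vars hx))]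
      · rw [h₂ x hx, TA.apply_of_notMem_own hA he ha hp hx]
    rw [this]
    exact .take p e b he ha ((TA.Enabled.congr hqp).1 hs) hb
  | skip h =>
    have : p' = p := by
      funext x
      by_cases hx : x ∈ (A k).own
      · rw [h₁ x hx, hqp x ((A k).own_subset_vars hx)]
      · exact h₂ x hx
    rw [this]
    exact .skip p fun e he ha hs => h e he ha ((TA.Enabled.congr hqp).2 hs)

theorem RcvOne.committed (h : RcvOne A δ k q true q') : (A k).Committed q := by
  cases h with
  | take e _ he ha hs hb => exact hs.committed (hb.1 rfl)

/-- Each reception writes only internal variables of its own automaton, and the other automaton does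
not read these; hence the two moves commute. -/
theorem RcvOne.swap {j : σ.Name} {q₁ q₂ : PVal σ} {b' : Bool} (h : RcvOne A δ k q b q₁)
    (h' : RcvOne A δ j q₁ b' q₂) (hk : (A k).Axioms) (hj : (A j).Axioms)
    (hqk : (A k).vars ⊆ q.dom) (hqj : (A j).vars ⊆ q.dom)
    (hkj : ∀ x ∈ (A k).own, x ∉ (A j).vars) (hjk : ∀ x ∈ (A j).own, x ∉ (A k).vars) :
    ∃ p, RcvOne A δ j q b' p ∧ RcvOne A δ k p b q₂ := by
  have hq₁ : (A j).vars ⊆ q₁.dom := h.dom ▸ hqj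
  -- The new intermediate valuation has the final internal variables of `j` and is otherwise still
  -- the initial one.
  have hA : RcvOne A δ j q b' (splice (A j).own q₂ q) :=
    h'.transfer hj hq₁ hqj (fun x hx => h.frame hk hqk fun hx' => hkj x hx' hx)
      (fun x hx => splice_of_mem _ _ hx) fun x hx => splice_of_notMem _ _ hx
  refine ⟨_, hA, h.transfer hk hqk (hA.dom ▸ hqk)
    (fun x hx => (splice_of_notMem _ _ fun hx' => hjk x hx' hx).symm) (fun x hx => ?_)
    fun x hx => ?_⟩
  · exact h'.frame hj hq₁ fun hx' => hkj x hx ((A j).own_subset_vars hx')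
  · by_cases hxj : x ∈ (A j).own
    · rw [splice_of_mem _ _ hxj]
    · rw [splice_of_notMem _ _ hxj, h'.frame hj hq₁ hxj, h.frame hk hqk hx]

end RcvOne

section Rcv

variable {δ : σ.Bcast} {L M : List σ.Name} {q q' : PVal σ} {b : Bool}

theorem netVars_cons_subset {k : σ.Name} {X : Set (Var σ)} (h : netVars A (k :: L) ⊆ X) :
    (A k).vars ⊆ X ∧ netVars A L ⊆ X :=
  ⟨(vars_subset_netVars List.mem_cons_self).trans h,
    (netVars_mono (List.subset_cons_self k L)).trans h⟩

theorem Rcv.dom (h : Rcv A δ L q b q') : q'.dom = q.dom := by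
  induction h with
  | nil => rfl
  | cons k L q q₁ q' b b' h _ ih => rw [ih, h.dom]

theorem Rcv.frame (h : Rcv A δ L q b q') (hA : ∀ k ∈ L, (A k).Axioms)
    (hq : netVars A L ⊆ q.dom) {x : Var σ} (hx : ∀ k ∈ L, x ∉ (A k).own) : q' x = q x := by
  induction h with
  | nil => rfl
  | cons k L q q₁ q' b b' h _ ih =>
    rw [List.forall_mem_cons] at hA hx
    have hq' := netVars_cons_subset hq
    rw [ih hA.2 (h.dom ▸ hq'.2) hx.2, h.frame hA.1 hq'.1 hx.1]

/-- The set `W` may exceed the variables of `L`: it has to stay fixed in the induction while the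
list shrinks. -/
theorem Rcv.transfer (h : Rcv A δ L q b q') (hA : ∀ k ∈ L, (A k).Axioms) {W : Set (Var σ)}
    {p p' : PVal σ} (hW : netVars A L ⊆ W) (hq : W ⊆ q.dom) (hp : W ⊆ p.dom)
    (hqp : ∀ x ∈ W, q x = p x) (h₁ : ∀ x ∈ W, p' x = q' x) (h₂ : ∀ x ∉ W, p' x = p x) :
    Rcv A δ L p b p' := by
  induction h generalizing p with
  | nil q =>
    have : p' = p := by
      funext x
      by_cases hx : x ∈ W
      · rw [h₁ x hx, hqp x hx]
      · exact h₂ x hx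
    rw [this]
    exact .nil p
  | cons k L q q₁ q' b b' h _ ih =>
    rw [List.forall_mem_cons] at hA
    obtain ⟨hk, hL⟩ := netVars_cons_subset hW
    have hs : RcvOne A δ k p b (splice W q₁ p) := by
      refine h.transfer hA.1 (hk.trans hq) (hk.trans hp) (fun x hx => hqp x (hk hx))
        (fun x hx => splice_of_mem _ _ (hk ((A k).own_subset_vars hx))) fun x hx => ?_
      by_cases hxW : x ∈ W
      · rw [splice_of_mem _ _ hxW, h.frame hA.1 (hk.trans hq) hx, hqp x hxW]
      · exact splice_of_notMem _ _ hxW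
    exact .cons k L p _ p' b b' hs (ih hA.2 hL (h.dom ▸ hq) (hs.dom ▸ hp)
      (fun x hx => (splice_of_mem _ _ hx).symm) h₁
      fun x hx => by rw [splice_of_notMem _ _ hx, h₂ x hx])

theorem Rcv.append (h : Rcv A δ L q b q') {b' : Bool} {q'' : PVal σ}
    (h' : Rcv A δ M q' b' q'') : Rcv A δ (L ++ M) q (b || b') q'' := by
  induction h with
  | nil q => simpa using h'
  | cons k L q q₁ q' b b₁ h _ ih =>
    rw [Bool.or_assoc]
    exact .cons k _ q q₁ _ b _ h (ih h')

theorem Rcv.of_append (h : Rcv A δ (L ++ M) q b q') :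
    ∃ b₁ q₁ b₂, Rcv A δ L q b₁ q₁ ∧ Rcv A δ M q₁ b₂ q' ∧ b = (b₁ || b₂) := by
  induction L generalizing q b with
  | nil => exact ⟨false, q, b, .nil q, h, by simp⟩
  | cons k L ih =>
    cases h with
    | cons _ _ _ q₁ _ b₁ b₂ h h' =>
      obtain ⟨b₃, q₂, b₄, h₁, h₂, rfl⟩ := ih h'
      exact ⟨_, q₂, b₄, .cons k L q q₁ q₂ b₁ b₃ h h₁, h₂, by rw [Bool.or_assoc]⟩

/-- Adjacent receivers commute by `RcvOne.swap`, and adjacent swaps generate all permutations. This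
reconciles the network order with the order imposed by grouping. -/
theorem Rcv.perm (h : Rcv A δ L q b q') (hLM : L.Perm M) (hL : Separated A L)
    (hq : netVars A L ⊆ q.dom) : Rcv A δ M q b q' := by
  induction hLM generalizing q b with
  | nil => exact h
  | cons k _ ih =>
    cases h with
    | cons _ _ _ q₁ _ b₁ b₂ h h' =>
      exact .cons k _ q q₁ q' b₁ b₂ h (ih h' hL.of_cons (h.dom ▸ (netVars_cons_subset hq).2))
  | swap j k L =>
    cases h with
    | cons _ _ _ q₁ _ b₁ b₂ h h' =>
      cases h' with
      | cons _ _ _ q₂ _ b₂ b₃ h' h'' =>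
        have hkj : k ≠ j := fun h => by
          have := hL.nodup
          simp [h] at this
        obtain ⟨p, h₁, h₂⟩ := h.swap h' (hL.ax k (by simp)) (hL.ax j (by simp))
          (netVars_cons_subset hq).1 (netVars_cons_subset (netVars_cons_subset hq).2).1
          (hL.own k (by simp) j (by simp) hkj) (hL.own j (by simp) k (by simp) hkj.symm)
        rw [← Bool.or_assoc, Bool.or_comm b₁, Bool.or_assoc]
        exact .cons j _ q p q' _ _ h₁ (.cons k _ p _ q' _ _ h₂ h'')
  | trans hLM _ ih₁ ih₂ =>
    exact ih₂ (ih₁ h hL hq) (hL.perm hLM) ((netVars_congr fun k => hLM.mem_iff) ▸ hq)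

/-- The flag of a later receiver is evaluated in an intermediate valuation, but earlier receivers do
not change its location, so it was committed from the start. -/
theorem Rcv.committed (h : Rcv A δ L q true q') (hL : Separated A L)
    (hq : netVars A L ⊆ q.dom) : ∃ k ∈ L, (A k).Committed q := by
  generalize hb : true = b at h
  induction h with
  | nil => cases hb
  | cons k L q q₁ q' b b' h _ ih =>
    cases b with
    | true => exact ⟨k, List.mem_cons_self, h.committed⟩
    | false =>
      obtain ⟨j, hj, hc⟩ := ih hL.of_cons (h.dom ▸ (netVars_cons_subset hq).2) (by simpa using hb)
      refine ⟨j, List.mem_cons_of_mem _ hj, (TA.Committed.congr ?_).1 hc⟩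
      refine h.frame (hL.ax k List.mem_cons_self) (netVars_cons_subset hq).1 fun hl => ?_
      have := (loc_mem_vars_iff _).1 ((A k).own_subset_vars hl)
      exact (List.nodup_cons.1 hL.nodup).1 (this ▸ hj)

end Rcv

end Flat

/-! ### Joint moves of a list of automata, and their splitting into two groups. -/

/-- The actions that are neither sending nor receiving a broadcast. -/
def DAct.IsLocal {σ : Sig} : DAct σ → Prop
  | .bsend _ => False
  | .brecv _ => False
  | _ => True

/-- The list without the name `i`. -/
noncomputable def others {σ : Sig} (N : List σ.Name) (i : σ.Name) : List σ.Name :=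
  open scoped Classical in N.filter fun j => j ≠ i

section Flat

variable {σ : Sig} {A : (k : σ.Name) → TA σ k}

theorem mem_others {N : List σ.Name} {i j : σ.Name} : j ∈ others N i ↔ j ∈ N ∧ j ≠ i := by
  simp [others]

theorem others_subset (N : List σ.Name) (i : σ.Name) : others N i ⊆ N :=
  fun _ h => (mem_others.1 h).1

theorem others_append (M N : List σ.Name) (i : σ.Name) :
    others (M ++ N) i = others M i ++ others N i := by
  simp [others]

theorem others_eq_self {N : List σ.Name} {i : σ.Name} (h : i ∉ N) : others N i = N := by
  simp only [others, List.filter_eq_self, decide_eq_true_eq]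
  exact fun j hj hji => h (hji ▸ hj)

theorem Separated.others {N : List σ.Name} (h : Separated A N) (i : σ.Name) :
    Separated A (others N i) :=
  h.subperm (h.nodup.filter _) (others_subset N i)

variable (A) in
/-- The discrete transitions that the listed automata can make together in a valuation of a superset
of their variables, without regard to committed locations and invariants. -/
inductive Flat (N : List σ.Name) : PVal σ → DAct σ → Bool → PVal σ → Prop
  | single (q : PVal σ) (a : DAct σ) (i : σ.Name) (e : Edge σ i) (b : Bool) (hi : i ∈ N)
      (he : e ∈ (A i).edges) (ha : e.act = a) (hl : a.IsLocal) (hs : (A i).Enabled e q)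
      (hb : b = true ↔ e.src ∈ (A i).K) : Flat N q a b ((A i).apply e q)
  | sync (q : PVal σ) (c : σ.Bin) (i j : σ.Name) (e : Edge σ i) (f : Edge σ j) (b b' : Bool)
      (hi : i ∈ N) (hj : j ∈ N) (hij : i ≠ j)
      (he : e ∈ (A i).edges) (hae : e.act = .send c) (hse : (A i).Enabled e q)
      (hf : f ∈ (A j).edges) (haf : f.act = .recv c) (hsf : (A j).Enabled f q)
      (hb : b = true ↔ e.src ∈ (A i).K) (hb' : b' = true ↔ f.src ∈ (A j).K) :
      Flat N q .tau (b || b') ((A j).apply f ((A i).apply e q))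
  | bsend (q : PVal σ) (δ : σ.Bcast) (i : σ.Name) (e : Edge σ i) (b b' : Bool) (q' : PVal σ)
      (hi : i ∈ N) (he : e ∈ (A i).edges) (ha : e.act = .bsend δ) (hs : (A i).Enabled e q)
      (hb : b = true ↔ e.src ∈ (A i).K) (h : Rcv A δ (others N i) ((A i).apply e q) b' q') :
      Flat N q (.bsend δ) (b || b') q'
  | brecv (q : PVal σ) (δ : σ.Bcast) (b : Bool) (q' : PVal σ) (h : Rcv A δ N q b q') :
      Flat N q (.brecv δ) b q'

variable {M N : List σ.Name} {q q' : PVal σ} {a : DAct σ} {b : Bool}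

theorem Flat.dom (h : Flat A N q a b q') : q'.dom = q.dom := by
  cases h with
  | single => rw [TA.dom_apply]
  | sync => rw [TA.dom_apply, TA.dom_apply]
  | bsend _ _ _ _ _ _ _ _ _ _ _ h => rw [h.dom, TA.dom_apply]
  | brecv _ _ _ h => exact h.dom

theorem Flat.frame (h : Flat A N q a b q') (hA : ∀ k ∈ N, (A k).Axioms)
    (hq : netVars A N ⊆ q.dom) {x : Var σ} (hx : x ∉ netVars A N) : q' x = q x := by
  have hx' : ∀ k ∈ N, x ∉ (A k).vars := fun k hk hxk => hx ⟨k, hk, hxk⟩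
  have hq' : ∀ k ∈ N, (A k).vars ⊆ q.dom := fun k hk => (vars_subset_netVars hk).trans hq
  cases h with
  | single a i e b hi he =>
    exact TA.apply_of_notMem_vars he (hq' i hi) (hx' i hi)
  | sync c i j e f b b' hi hj hij he _ _ hf =>
    rw [TA.apply_of_notMem_vars hf (TA.dom_apply e q ▸ hq' j hj) (hx' j hj),
      TA.apply_of_notMem_vars he (hq' i hi) (hx' i hi)]
  | bsend δ i e b b' q' hi he _ _ _ h =>
    rw [h.frame (fun k hk => hA k (others_subset _ _ hk))
      (TA.dom_apply e q ▸ (netVars_mono (others_subset _ _)).trans hq)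
      fun k hk hxk => hx' k (others_subset _ _ hk) ((A k).own_subset_vars hxk),
      TA.apply_of_notMem_vars he (hq' i hi) (hx' i hi)]
  | brecv δ b q' h =>
    exact h.frame hA hq fun k hk hxk => hx' k hk ((A k).own_subset_vars hxk)

theorem Flat.brecv_frame {δ : σ.Bcast} (h : Flat A N q (.brecv δ) b q')
    (hA : ∀ k ∈ N, (A k).Axioms) (hq : netVars A N ⊆ q.dom) {x : Var σ}
    (hx : ∀ k ∈ N, x ∉ (A k).own) : q' x = q x := by
  cases h with
  | single _ _ _ _ _ _ _ hl => exact hl.elim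
  | brecv _ _ _ h => exact h.frame hA hq hx

/-- Locality of joint moves. It is the passage between a group and the whole network (`restrict`,
`extend`), and between the concrete and the abstract network. -/
theorem Flat.transfer (h : Flat A N q a b q') (hA : ∀ k ∈ N, (A k).Axioms) {W : Set (Var σ)}
    {p p' : PVal σ} (hW : netVars A N ⊆ W) (hq : W ⊆ q.dom) (hp : W ⊆ p.dom)
    (hqp : ∀ x ∈ W, q x = p x) (h₁ : ∀ x ∈ W, p' x = q' x) (h₂ : ∀ x ∉ W, p' x = p x) :
    Flat A N p a b p' := by
  have hkW : ∀ k ∈ N, (A k).vars ⊆ W := fun k hk => (vars_subset_netVars hk).trans hW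
  have ap : ∀ k ∈ N, ∀ e ∈ (A k).edges, ∀ x ∈ W, (A k).apply e q x = (A k).apply e p x :=
    fun k hk e he x hx => TA.apply_congr he ((hkW k hk).trans hq) ((hkW k hk).trans hp)
      (fun y hy => hqp y (hkW k hk hy)) (hqp x hx)
  have ap' : ∀ k ∈ N, ∀ e ∈ (A k).edges, ∀ x ∉ W, (A k).apply e p x = p x :=
    fun k hk e he x hx => TA.apply_of_notMem_vars he ((hkW k hk).trans hp)
      fun h => hx (hkW k hk h)
  have en : ∀ k ∈ N, ∀ e : Edge σ k, (A k).Enabled e q → (A k).Enabled e p :=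
    fun k hk e he => (TA.Enabled.congr fun x hx => hqp x (hkW k hk hx)).1 he
  cases h with
  | single a i e b hi he ha hl hs hb =>
    have : p' = (A i).apply e p := by
      funext x
      by_cases hx : x ∈ W
      · rw [h₁ x hx, ap i hi e he x hx]
      · rw [h₂ x hx, ap' i hi e he x hx]
    exact this ▸ .single p a i e b hi he ha hl (en i hi e hs) hb
  | sync c i j e f b b' hi hj hij he hae hse hf haf hsf hb hb' =>
    have : p' = (A j).apply f ((A i).apply e p) := by
      funext x
      by_cases hx : x ∈ W
      · rw [h₁ x hx]
        exact TA.apply_congr hf ((TA.dom_apply e q).symm ▸ (hkW j hj).trans hq)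
          ((TA.dom_apply e p).symm ▸ (hkW j hj).trans hp)
          (fun y hy => ap i hi e he y (hkW j hj hy)) (ap i hi e he x hx)
      · rw [h₂ x hx, TA.apply_of_notMem_vars hf ((TA.dom_apply e p).symm ▸ (hkW j hj).trans hp)
          fun h => hx (hkW j hj h), ap' i hi e he x hx]
    exact this ▸ .sync p c i j e f b b' hi hj hij he hae (en i hi e hse) hf haf (en j hj f hsf)
      hb hb'
  | bsend δ i e b b' q' hi he ha hs hb h =>
    refine .bsend p δ i e b b' p' hi he ha (en i hi e hs) hb ?_
    exact h.transfer (fun k hk => hA k (others_subset _ _ hk))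
      ((netVars_mono (others_subset _ _)).trans hW) ((TA.dom_apply e q).symm ▸ hq)
      ((TA.dom_apply e p).symm ▸ hp) (ap i hi e he) h₁
      fun x hx => by rw [h₂ x hx, ap' i hi e he x hx]
  | brecv δ b q' h => exact .brecv p δ b p' (h.transfer hA hW hq hp hqp h₁ h₂)

theorem Flat.restrict (h : Flat A N q a b q') (hA : ∀ k ∈ N, (A k).Axioms) {W : Set (Var σ)}
    (hW : netVars A N ⊆ W) (hq : W ⊆ q.dom) :
    Flat A N (q.restrict W) a b (q'.restrict W) :=
  h.transfer hA hW hq (by rw [dom_restrict]; exact fun x hx => ⟨hq hx, hx⟩)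
    (fun x hx => (restrict_of_mem q hx).symm) (fun x hx => restrict_of_mem q' hx)
    fun x hx => by rw [restrict_of_notMem _ hx, restrict_of_notMem _ hx]

theorem Flat.extend {r' : PVal σ} (h : Flat A N (q.restrict (netVars A N)) a b r')
    (hA : ∀ k ∈ N, (A k).Axioms) (hq : netVars A N ⊆ q.dom) :
    Flat A N q a b (splice (netVars A N) r' q) :=
  h.transfer hA subset_rfl (by rw [dom_restrict]; exact fun x hx => ⟨hq hx, hx⟩) hq
    (fun x hx => restrict_of_mem q hx) (fun x hx => splice_of_mem _ _ hx)
    fun x hx => splice_of_notMem _ _ hx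

theorem Flat.perm (h : Flat A M q a b q') (hMN : M.Perm N) (hM : Separated A M)
    (hq : netVars A M ⊆ q.dom) : Flat A N q a b q' := by
  cases h with
  | single a i e b hi he ha hl hs hb =>
    exact .single q a i e b (hMN.subset hi) he ha hl hs hb
  | sync c i j e f b b' hi hj hij he hae hse hf haf hsf hb hb' =>
    exact .sync q c i j e f b b' (hMN.subset hi) (hMN.subset hj) hij he hae hse hf haf hsf hb hb'
  | bsend δ i e b b' q' hi he ha hs hb h =>
    exact .bsend q δ i e b b' q' (hMN.subset hi) he ha hs hb (h.perm (hMN.filter _)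
      (hM.others i) (TA.dom_apply e q ▸ (netVars_mono (others_subset _ _)).trans hq))
  | brecv δ b q' h => exact .brecv q δ b q' (h.perm hMN hM hq)

theorem Flat.committed (h : Flat A N q a true q') (hN : Separated A N)
    (hq : netVars A N ⊆ q.dom) : ∃ k ∈ N, (A k).Committed q := by
  generalize hb₀ : true = b at h
  cases h with
  | single a i e b hi he ha hl hs hb => exact ⟨i, hi, hs.committed (hb.1 hb₀.symm)⟩
  | sync c i j e f b b' hi hj hij he hae hse hf haf hsf hb hb' =>
    rcases Bool.or_eq_true_iff.1 hb₀.symm with h | h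
    · exact ⟨i, hi, hse.committed (hb.1 h)⟩
    · exact ⟨j, hj, hsf.committed (hb'.1 h)⟩
  | bsend δ i e b b' q' hi he ha hs hb h =>
    rcases Bool.or_eq_true_iff.1 hb₀.symm with hc | hc
    · exact ⟨i, hi, hs.committed (hb.1 hc)⟩
    · subst hc
      obtain ⟨j, hj, hc⟩ := h.committed (hN.others i)
        (TA.dom_apply e q ▸ (netVars_mono (others_subset _ _)).trans hq)
      obtain ⟨hj, hji⟩ := mem_others.1 hj
      refine ⟨j, hj, (TA.Committed.congr ?_).1 hc⟩
      exact TA.apply_of_notMem_vars he ((vars_subset_netVars hi).trans hq)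
        fun h => hji ((loc_mem_vars_iff _).1 h)
  | brecv δ b q' h => exact (hb₀ ▸ h).committed hN hq

variable (A) in
/-- The discrete transitions of two groups of automata in terms of those of the groups, where the
first group makes the first move. -/
inductive Dec (M N : List σ.Name) : PVal σ → DAct σ → Bool → PVal σ → Prop
  | single (q : PVal σ) (a : DAct σ) (b : Bool) (q' : PVal σ) (hl : a.IsLocal)
      (h : Flat A M q a b q') : Dec M N q a b q'
  | sync (q : PVal σ) (c : σ.Bin) (b b' : Bool) (q₁ q' : PVal σ)
      (h : Flat A M q (.send c) b q₁) (h' : Flat A N q₁ (.recv c) b' q') :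
      Dec M N q .tau (b || b') q'
  | bsend (q : PVal σ) (δ : σ.Bcast) (b b' : Bool) (q₁ q' : PVal σ)
      (h : Flat A M q (.bsend δ) b q₁) (h' : Flat A N q₁ (.brecv δ) b' q') :
      Dec M N q (.bsend δ) (b || b') q'
  | brecv (q : PVal σ) (δ : σ.Bcast) (b b' : Bool) (q₁ q' : PVal σ)
      (h : Flat A M q (.brecv δ) b q₁) (h' : Flat A N q₁ (.brecv δ) b' q') :
      Dec M N q (.brecv δ) (b || b') q'

/-- In a network all guards are evaluated before the step, in a composition the receiver sees the
sender's update. For inputs this makes no difference, since the sender does not write the receiver's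
internal variables. -/
theorem Separated.input_enabled_apply (hN : Separated A N) {i j : σ.Name} (hi : i ∈ N)
    (hj : j ∈ N) (hij : i ≠ j) {e : Edge σ i} (he : e ∈ (A i).edges) {f : Edge σ j}
    (hf : f ∈ (A j).edges) (haf : (∃ δ, f.act = .brecv δ) ∨ ∃ c, f.act = .recv c)
    (hq : netVars A N ⊆ q.dom) :
    (A j).Enabled f ((A i).apply e q) ↔ (A j).Enabled f q := by
  have hqi := (vars_subset_netVars hi).trans hq
  have hqj := (vars_subset_netVars hj).trans hq
  exact TA.Enabled.congr_own (hN.ax j hj) hf haf ((TA.dom_apply e q).symm ▸ hqj) hqj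
    fun x hx => TA.apply_of_notMem_vars he hqi (hN.own j hj i hi hij.symm x hx)

/-- The group of the initiator moves first. A binary synchronisation inside one group counts as a
single τ of that group; across the groups it becomes a send followed by a receive. -/
theorem Flat.dec_of_perm {L : List σ.Name} (h : Flat A L q a b q') (hLM : L.Perm (M ++ N))
    (hL : Separated A L) (hq : netVars A L ⊆ q.dom) :
    Dec A M N q a b q' ∨ Dec A N M q a b q' := by
  have hMN := hL.perm hLM
  have hqMN : netVars A (M ++ N) ⊆ q.dom := (netVars_mono hLM.symm.subset).trans hq
  replace h := h.perm hLM hL hq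
  cases h with
  | single a i e b hi he ha hl hs hb =>
    rcases List.mem_append.1 hi with hi | hi
    · exact .inl (.single q a b _ hl (.single q a i e b hi he ha hl hs hb))
    · exact .inr (.single q a b _ hl (.single q a i e b hi he ha hl hs hb))
  | sync c i j e f b b' hi hj hij he hae hse hf haf hsf hb hb' =>
    have hsf' := (hMN.input_enabled_apply hi hj hij he hf (.inr ⟨c, haf⟩) hqMN).2 hsf
    rcases List.mem_append.1 hi with hi | hi <;> rcases List.mem_append.1 hj with hj | hj
    · exact .inl (.single q _ _ _ trivial
        (.sync q c i j e f b b' hi hj hij he hae hse hf haf hsf hb hb'))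
    · exact .inl (.sync q c b b' _ _ (.single q _ i e b hi he hae trivial hse hb)
        (.single _ _ j f b' hj hf haf trivial hsf' hb'))
    · exact .inr (.sync q c b b' _ _ (.single q _ i e b hi he hae trivial hse hb)
        (.single _ _ j f b' hj hf haf trivial hsf' hb'))
    · exact .inr (.single q _ _ _ trivial
        (.sync q c i j e f b b' hi hj hij he hae hse hf haf hsf hb hb'))
  | bsend δ i e b b' q' hi he ha hs hb h =>
    -- The sender's group completes its part of the broadcast before the other group receives as a
    -- whole.
    have key : ∀ M N : List σ.Name, Separated A (M ++ N) → i ∈ M →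
        Rcv A δ (others (M ++ N) i) ((A i).apply e q) b' q' →
        Dec A M N q (.bsend δ) (b || b') q' := by
      intro M N hMN hi h
      rw [others_append, others_eq_self (N := N) fun hi' => hMN.ne hi hi' rfl] at h
      obtain ⟨b₁, q₁, b₂, h₁, h₂, rfl⟩ := h.of_append
      rw [← Bool.or_assoc]
      exact .bsend q δ _ b₂ q₁ q' (.bsend q δ i e b b₁ q₁ hi he ha hs hb h₁) (.brecv _ δ _ _ h₂)
    rcases List.mem_append.1 hi with hi | hi
    · exact .inl (key M N hMN hi h)
    · exact .inr (key N M hMN.swap hi (h.perm (List.perm_append_comm.filter _) (hMN.others i)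
        (TA.dom_apply e q ▸ (netVars_mono (others_subset _ _)).trans hqMN)))
  | brecv δ b q' h =>
    obtain ⟨b₁, q₁, b₂, h₁, h₂, rfl⟩ := h.of_append
    -- A pure reception has no initiator, so the first alternative always applies.
    exact .inl (.brecv q δ b₁ b₂ q₁ q' (.brecv _ δ _ _ h₁) (.brecv _ δ _ _ h₂))

theorem Flat.dec (h : Flat A (M ++ N) q a b q') (hMN : Separated A (M ++ N))
    (hq : netVars A (M ++ N) ⊆ q.dom) : Dec A M N q a b q' ∨ Dec A N M q a b q' :=
  h.dec_of_perm (List.Perm.refl _) hMN hq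

/-- Broadcast actions must be excluded, because a longer list has more receivers. -/
theorem Flat.mono_of_isLocal (h : Flat A M q a b q') (hl : a.IsLocal) (hMN : M ⊆ N) :
    Flat A N q a b q' := by
  cases h with
  | single a i e b hi he ha hl hs hb => exact .single q a i e b (hMN hi) he ha hl hs hb
  | sync c i j e f b b' hi hj hij he hae hse hf haf hsf hb hb' =>
    exact .sync q c i j e f b b' (hMN hi) (hMN hj) hij he hae hse hf haf hsf hb hb'
  | bsend => exact hl.elim
  | brecv => exact hl.elim

theorem Dec.flat (h : Dec A M N q a b q') (hMN : Separated A (M ++ N))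
    (hq : netVars A (M ++ N) ⊆ q.dom) : Flat A (M ++ N) q a b q' := by
  cases h with
  | single a b q' hl h => exact h.mono_of_isLocal hl (List.subset_append_left M N)
  | sync c b b' q₁ q' h h' =>
    cases h with
    | single _ i e _ hi he hae _ hse hb =>
      cases h' with
      | single _ j f _ hj hf haf _ hsf hb' =>
        have hi' := List.mem_append_left N hi
        have hj' := List.mem_append_right M hj
        have hij := hMN.ne hi hj
        exact .sync q c i j e f b b' hi' hj' hij he hae hse hf haf
          ((hMN.input_enabled_apply hi' hj' hij he hf (.inr ⟨c, haf⟩) hq).1 hsf) hb hb'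
  | bsend δ b b' q₁ q' h h' =>
    cases h with
    | single _ _ _ _ _ _ _ hl => exact hl.elim
    | bsend _ i e b b₁ q₁ hi he ha hs hb h =>
      cases h' with
      | single _ _ _ _ _ _ _ hl => exact hl.elim
      | brecv _ _ _ h' =>
        rw [Bool.or_assoc]
        refine .bsend q δ i e b _ q' (List.mem_append_left N hi) he ha hs hb ?_
        rw [others_append, others_eq_self (N := N) fun hi' => hMN.ne hi hi' rfl]
        exact h.append h'
  | brecv δ b b' q₁ q' h h' =>
    cases h with
    | single _ _ _ _ _ _ _ hl => exact hl.elim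
    | brecv _ _ _ h =>
      cases h' with
      | single _ _ _ _ _ _ _ hl => exact hl.elim
      | brecv _ _ _ h' => exact .brecv q δ _ q' (h.append h')

theorem Dec.flat_swap (h : Dec A N M q a b q') (hMN : Separated A (M ++ N))
    (hq : netVars A (M ++ N) ⊆ q.dom) : Flat A (M ++ N) q a b q' :=
  have hq' : netVars A (N ++ M) ⊆ q.dom := (netVars_mono List.perm_append_comm.subset).trans hq
  (h.flat hMN.swap hq').perm List.perm_append_comm hMN.swap hq'

end Flat

/-! ### States of a combined network as merges of states of its two groups. -/

theorem PVal.restrict_override_restrict {σ : Sig} {X Y : Set (Var σ)} {f f' g : PVal σ}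
    (hX : ∀ x ∈ X, f x = g x) (hY : ∀ x ∈ Y, x ∉ X → f' x = g x) (hf : X ⊆ f.dom)
    (hg : g.dom ⊆ X ∪ Y) : (f.restrict X).override (f'.restrict Y) = g := by
  funext x
  by_cases hx : x ∈ X
  · rw [override_of_mem _ (by rw [dom_restrict]; exact ⟨hf hx, hx⟩), restrict_of_mem _ hx, hX x hx]
  · rw [override_of_notMem _ (by rw [dom_restrict]; exact fun h => hx h.2)]
    by_cases hy : x ∈ Y
    · rw [restrict_of_mem _ hy, hY x hy hx]
    · rw [restrict_of_notMem _ hy, notMem_dom.1 fun h => (hg h).elim hx hy]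

theorem PVal.restrict_compat_restrict {σ : Sig} (f : PVal σ) (X Y : Set (Var σ)) :
    (f.restrict X).Compat (f.restrict Y) := by
  rintro x ⟨hx, hy⟩
  rw [dom_restrict] at hx hy
  rw [restrict_of_mem _ hx.2, restrict_of_mem _ hy.2]

theorem PVal.override_comm {σ : Sig} {f g : PVal σ} (h : f.Compat g) :
    f.override g = g.override f := by
  funext x
  by_cases hx : x ∈ g.dom
  · rw [override_eq_right h hx, override_of_mem _ hx]
  · rw [override_of_notMem _ hx]
    by_cases hf : x ∈ f.dom
    · rw [override_of_mem _ hf]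
    · rw [override_of_notMem _ hf, notMem_dom.1 hx, notMem_dom.1 hf]

theorem PVal.delay_override (f g : PVal σ) (d : ℝ≥0) :
    (f.override g).delay d = (f.delay d).override (g.delay d) := by
  funext x
  by_cases hx : x ∈ f.dom
  · rw [override_of_mem _ (dom_delay f d ▸ hx), delay_congr (override_of_mem g hx)]
  · rw [override_of_notMem _ (dom_delay f d ▸ hx), delay_congr (override_of_notMem g hx)]

section States

variable {σ : Sig} {A : (k : σ.Name) → TA σ k} {M N : List σ.Name} {q q' r s : PVal σ}

theorem netStates_dom (h : q ∈ netStates A N) : q.dom = netVars A N := h.1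

theorem netStates_perm (hMN : M.Perm N) : netStates A M = netStates A N := by
  have : netVars A M = netVars A N := netVars_congr fun k => hMN.mem_iff
  ext q
  simp only [netStates, this, hMN.mem_iff]

theorem netStates_append_comm : netStates A (M ++ N) = netStates A (N ++ M) :=
  netStates_perm List.perm_append_comm

theorem restrict_mem_netStates (hq : netVars A M ⊆ q.dom) (h : ∀ k ∈ M, (A k).InvHolds q) :
    q.restrict (netVars A M) ∈ netStates A M :=
  ⟨restrict_mem_Val hq, fun k hk => (TA.InvHolds.congr_vars fun _ hx =>
    restrict_of_mem q (vars_subset_netVars hk hx)).2 (h k hk)⟩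

theorem netStates_left (h : q ∈ netStates A (M ++ N)) :
    q.restrict (netVars A M) ∈ netStates A M :=
  restrict_mem_netStates (by rw [h.1, netVars_append]; exact Set.subset_union_left)
    fun k hk => h.2 k (List.mem_append_left N hk)

theorem netStates_right (h : q ∈ netStates A (M ++ N)) :
    q.restrict (netVars A N) ∈ netStates A N :=
  netStates_left (netStates_append_comm ▸ h)

/-- No compatibility of `r` and `s` is needed: `r` may overwrite shared variables of `s`, but the
invariants of `N` see only internal variables. -/
theorem override_mem_netStates (hMN : Separated A (M ++ N)) (hr : r ∈ netStates A M)
    (hs : s ∈ netStates A N) : r.override s ∈ netStates A (M ++ N) := by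
  have hd : (r.override s).dom = netVars A (M ++ N) := by
    rw [dom_override, netStates_dom hr, netStates_dom hs, netVars_append]
  refine ⟨hd, fun k hk => ?_⟩
  rcases List.mem_append.1 hk with hk' | hk'
  · refine (TA.InvHolds.congr_vars fun x hx => override_of_mem s ?_).2 (hr.2 k hk')
    exact netStates_dom hr ▸ vars_subset_netVars hk' hx
  · refine (TA.InvHolds.congr (hMN.ax k hk) (hd ▸ vars_subset_netVars hk)
      (netStates_dom hs ▸ vars_subset_netVars hk') fun x hx => override_of_notMem s ?_).2 (hs.2 k hk')
    exact netStates_dom hr ▸ hMN.swap.own_notMem_left hk' hx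

/-- The state between the moves of two groups of automata satisfies all invariants. -/
theorem Flat.mid_mem_netStates {a a' : DAct σ} {b b' : Bool} {q₁ : PVal σ}
    (h : Flat A M q a b q₁) (h' : Flat A N q₁ a' b' q') (hMN : Separated A (M ++ N))
    (hq : q ∈ netStates A (M ++ N)) (hq' : q' ∈ netStates A (M ++ N)) :
    q₁ ∈ netStates A (M ++ N) := by
  have hdM : netVars A M ⊆ q.dom := hq.1 ▸ netVars_mono (List.subset_append_left M N)
  have hdN : netVars A N ⊆ q₁.dom := h.dom ▸ hq.1 ▸ netVars_mono (List.subset_append_right M N)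
  have hd : q₁.dom = netVars A (M ++ N) := h.dom.trans hq.1
  refine ⟨hd, fun k hk => ?_⟩
  have hv : ∀ p : PVal σ, p ∈ netStates A (M ++ N) → (A k).vars ⊆ p.dom :=
    fun p hp => hp.1 ▸ vars_subset_netVars hk
  have hv₁ : (A k).vars ⊆ q₁.dom := hd ▸ vars_subset_netVars hk
  rcases List.mem_append.1 hk with hk' | hk'
  · exact (TA.InvHolds.congr (hMN.ax k hk) (hv q' hq') hv₁ fun x hx =>
      h'.frame hMN.right.ax hdN (hMN.own_notMem_left hk' hx)).1 (hq'.2 k hk)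
  · exact (TA.InvHolds.congr (hMN.ax k hk) hv₁ (hv q hq) fun x hx =>
      h.frame hMN.left.ax hdM (hMN.swap.own_notMem_left hk' hx)).2 (hq.2 k hk)

end States

/-! ### Compositions of TTSBs represent joint moves. -/

section Represents

variable {σ : Sig} {A : (k : σ.Name) → TA σ k} {M N : List σ.Name}

variable (A) in
/-- No listed automaton is in a committed location, and none has an enabled urgent transition. -/
def CanDelay (N : List σ.Name) (q : PVal σ) : Prop :=
  (∀ k ∈ N, ¬ (A k).Committed q) ∧ ∀ k ∈ N, ¬ (A k).UrgentEnabled q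

theorem CanDelay.congr {q p : PVal σ} (h : ∀ x ∈ netVars A N, q x = p x) :
    CanDelay A N q ↔ CanDelay A N p :=
  and_congr
    (forall₂_congr fun k hk => not_congr <|
      TA.Committed.congr (h _ (vars_subset_netVars hk (A k).loc_mem_vars)))
    (forall₂_congr fun _ hk => not_congr <|
      TA.UrgentEnabled.congr fun x hx => h x (vars_subset_netVars hk hx))

theorem CanDelay.append {q : PVal σ} :
    CanDelay A (M ++ N) q ↔ CanDelay A M q ∧ CanDelay A N q := by
  simp only [CanDelay, List.forall_mem_append]
  tauto

theorem CanDelay.restrict_iff {q : PVal σ} :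
    CanDelay A N (q.restrict (netVars A N)) ↔ CanDelay A N q :=
  CanDelay.congr fun _ hx => restrict_of_mem q hx

variable (A) in
/-- The discrete transitions of `T` are those of the listed automata, where uncommitted internal
transitions in states with a committed location are optional. -/
structure Represents (T : TTSB σ) (N : List σ.Name) : Prop where
  ext : T.E = {x | ∃ k ∈ N, x ∈ (A k).E}
  states : T.S = netStates A N
  sound : ∀ r a b r', T.Tr r (.disc a) b r' →
    r ∈ netStates A N ∧ r' ∈ netStates A N ∧ Flat A N r a b r'
  complete : ∀ r a b r', r ∈ netStates A N → r' ∈ netStates A N → Flat A N r a b r' →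
    (a = .tau → b = true ∨ ∀ k ∈ N, ¬ (A k).Committed r) → T.Tr r (.disc a) b r'
  time : ∀ r d b r', T.Tr r (.time d) b r' ↔
    r ∈ netStates A N ∧ r' ∈ netStates A N ∧ b = false ∧ r' = r.delay d ∧ CanDelay A N r

/-- By `sound`, a committed transition has a participant that starts in a committed location, and
delays are never committed. This one direction suffices to discharge all side conditions on `Comm`.
-/
theorem Represents.committed {T : TTSB σ} (h : Represents A T N) (hN : Separated A N)
    {r : PVal σ} (hr : T.Comm r) : ∃ k ∈ N, (A k).Committed r := by
  obtain ⟨a | d, t, ht⟩ := hr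
  · obtain ⟨hr, -, hf⟩ := h.sound _ _ _ _ ht
    exact hf.committed hN hr.1.symm.subset
  · simpa using ((h.time _ _ _ _).1 ht).2.2.1

/-- Component moves are lifted to merged valuations by locality; side conditions on commitment are
simply dropped. -/
theorem ParRule.sound {T₁ T₂ : TTSB σ} (h₁ : Represents A T₁ M) (h₂ : Represents A T₂ N)
    (hMN : Separated A (M ++ N)) {q q' : PVal σ} {a : DAct σ} {b : Bool}
    (h : TTSB.ParRule T₁ T₂ q (.disc a) b q') :
    q ∈ netStates A (M ++ N) ∧ q' ∈ netStates A (M ++ N) ∧ Dec A M N q a b q' := by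
  have lift : ∀ {a b r r'} (s : PVal σ), r ∈ netStates A M → r' ∈ netStates A M →
      Flat A M r a b r' → Flat A M (r.override s) a b (r'.override s) := by
    intro a b r r' s hr hr' h
    refine h.transfer hMN.left.ax subset_rfl hr.1.symm.subset ?_ (fun x hx => ?_)
      (fun x hx => ?_) fun x hx => ?_
    · rw [dom_override, netStates_dom hr]; exact Set.subset_union_left
    · rw [override_of_mem _ (netStates_dom hr ▸ hx)]
    · rw [override_of_mem _ (netStates_dom hr' ▸ hx)]
    · rw [override_of_notMem _ (netStates_dom hr' ▸ hx),
        override_of_notMem _ (netStates_dom hr ▸ hx)]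
  -- The second group moves after the first: `s₁` is what it sees of the merge `r' ▷ s`, and its
  -- result takes precedence over `r'`.
  have lift' : ∀ {a b r' s s₁ s'}, s ∈ netStates A N → s₁ ∈ netStates A N → s' ∈ netStates A N →
      (∀ x ∈ netVars A N, s₁ x = r'.override s x) →
      Flat A N s₁ a b s' → Flat A N (r'.override s) a b (s'.override r') := by
    intro a b r' s s₁ s' hs hs₁ hs' hx h
    refine h.transfer hMN.right.ax subset_rfl hs₁.1.symm.subset ?_ hx
      (fun x hx => ?_) fun x hx => ?_
    · rw [dom_override, netStates_dom hs]; exact Set.subset_union_right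
    · rw [override_of_mem _ (netStates_dom hs' ▸ hx)]
    · rw [override_of_notMem _ (netStates_dom hs' ▸ hx)]
      by_cases hr : x ∈ r'.dom
      · rw [override_of_mem _ hr]
      · have hxs : x ∉ s.dom := netStates_dom hs ▸ hx
        rw [override_of_notMem _ hr, notMem_dom.1 hr, notMem_dom.1 hxs]
  have upd : ∀ {s r' : PVal σ}, s ∈ netStates A N →
      ∀ x ∈ netVars A N, s.update r' x = r'.override s x := by
    intro s r' hs x hx
    by_cases hr : x ∈ r'.dom
    · rw [override_of_mem _ hr, update_of_mem (netStates_dom hs ▸ hx) hr]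
    · rw [override_of_notMem _ hr, update_of_notMem hr]
  have st : ∀ {r s}, r ∈ netStates A M → s ∈ netStates A N →
      r.override s ∈ netStates A (M ++ N) := override_mem_netStates hMN
  have st' : ∀ {r s}, r ∈ netStates A M → s ∈ netStates A N →
      s.override r ∈ netStates A (M ++ N) := fun hr hs =>
    netStates_append_comm ▸ override_mem_netStates hMN.swap hs hr
  have shM : ∀ x ∈ netVars A M, ∀ k ∈ N, x ∉ (A k).own :=
    fun x hx k hk hxk => hMN.swap.own_notMem_left hk hxk hx
  have shN : ∀ x ∈ netVars A N, ∀ k ∈ M, x ∉ (A k).own :=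
    fun x hx k hk hxk => hMN.own_notMem_left hk hxk hx
  cases h with
  | send r s r' c b hr hs hrs h =>
    rw [h₂.states] at hs
    obtain ⟨hr, hr', h⟩ := h₁.sound _ _ _ _ h
    exact ⟨st hr hs, st hr' hs, .single _ _ _ _ trivial (lift s hr hr' h)⟩
  | recv r s r' c b hr hs hrs h =>
    rw [h₂.states] at hs
    obtain ⟨hr, hr', h⟩ := h₁.sound _ _ _ _ h
    exact ⟨st hr hs, st hr' hs, .single _ _ _ _ trivial (lift s hr hr' h)⟩
  | tau r s r' b hr hs hrs h =>
    rw [h₂.states] at hs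
    obtain ⟨hr, hr', h⟩ := h₁.sound _ _ _ _ h
    exact ⟨st hr hs, st hr' hs, .single _ _ _ _ trivial (lift s hr hr' h)⟩
  | sync r s r' s' c b b' hr hs hrs h h' hc =>
    rw [h₂.states] at hs
    obtain ⟨hr, hr', h⟩ := h₁.sound _ _ _ _ h
    obtain ⟨hs₁, hs', h'⟩ := h₂.sound _ _ _ _ h'
    exact ⟨st hr hs, st' hr' hs', .sync _ c b b' _ _ (lift s hr hr' h)
      (lift' hs hs₁ hs' (upd hs) h')⟩
  | snd r s r' s' δ b b' hr hs hrs h h' =>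
    rw [h₂.states] at hs
    obtain ⟨hr, hr', h⟩ := h₁.sound _ _ _ _ h
    obtain ⟨hs₁, hs', h'⟩ := h₂.sound _ _ _ _ h'
    -- The receiver leaves shared variables at the sender's values, so the override in the broadcast
    -- rule may be taken in either order.
    have hc : r'.Compat s' := by
      rintro x ⟨hx, hx'⟩
      rw [netStates_dom hr'] at hx
      rw [netStates_dom hs'] at hx'
      rw [h'.brecv_frame hMN.right.ax hs₁.1.symm.subset (shM x hx), upd hs x hx',
        override_of_mem _ (netStates_dom hr' ▸ hx)]
    refine ⟨st hr hs, st hr' hs', .bsend _ δ b b' _ _ (lift s hr hr' h) ?_⟩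
    rw [override_comm hc]
    exact lift' hs hs₁ hs' (upd hs) h'
  | rcv r s r' s' δ b b' hr hs hrs h h' =>
    obtain ⟨hr, hr', h⟩ := h₁.sound _ _ _ _ h
    obtain ⟨hs, hs', h'⟩ := h₂.sound _ _ _ _ h'
    have hrs' : ∀ x ∈ netVars A M, x ∈ netVars A N → r' x = s x := fun x hx hx' => by
      rw [h.brecv_frame hMN.left.ax hr.1.symm.subset (shN x hx'),
        hrs x ⟨netStates_dom hr ▸ hx, netStates_dom hs ▸ hx'⟩]
    have hc : r'.Compat s' := by
      rintro x ⟨hx, hx'⟩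
      rw [netStates_dom hr'] at hx
      rw [netStates_dom hs'] at hx'
      rw [h'.brecv_frame hMN.right.ax hs.1.symm.subset (shM x hx), hrs' x hx hx']
    refine ⟨st hr hs, st hr' hs', .brecv _ δ b b' _ _ (lift s hr hr' h) ?_⟩
    rw [override_comm hc]
    refine lift' hs hs hs' (fun x hx => ?_) h'
    by_cases hxr : x ∈ r'.dom
    · rw [override_of_mem _ hxr, hrs' x (netStates_dom hr' ▸ hxr) hx]
    · rw [override_of_notMem _ hxr]

/-- The rules need legal states for each half of the move. `mid_mem_netStates` provides the
intermediate one, and restricting it to the two sets of variables gives the component states. -/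
theorem ParRule.complete {T₁ T₂ : TTSB σ} (h₁ : Represents A T₁ M) (h₂ : Represents A T₂ N)
    (hMN : Separated A (M ++ N)) {q q' : PVal σ} {a : DAct σ} {b : Bool}
    (hq : q ∈ netStates A (M ++ N)) (hq' : q' ∈ netStates A (M ++ N))
    (h : Dec A M N q a b q')
    (hc : a = .tau → b = true ∨ ∀ k ∈ M ++ N, ¬ (A k).Committed q) :
    TTSB.ParRule T₁ T₂ q (.disc a) b q' := by
  set X := netVars A M with hX
  set Y := netVars A N with hY
  have dom_eq : ∀ {p : PVal σ}, p ∈ netStates A (M ++ N) → p.dom = X ∪ Y :=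
    fun {p} hp => hp.1.trans (netVars_append M N)
  have domX : ∀ {p : PVal σ}, p ∈ netStates A (M ++ N) → X ⊆ p.dom :=
    fun {p} hp => dom_eq hp ▸ Set.subset_union_left
  have domY : ∀ {p : PVal σ}, p ∈ netStates A (M ++ N) → Y ⊆ p.dom :=
    fun {p} hp => dom_eq hp ▸ Set.subset_union_right
  have eq_self : ∀ {p : PVal σ}, p ∈ netStates A (M ++ N) →
      (p.restrict X).override (p.restrict Y) = p := fun {p} hp =>
    restrict_override_restrict (fun _ _ => rfl) (fun _ _ _ => rfl) (domX hp) (dom_eq hp).subset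
  have eq_left : ∀ {p p₁ : PVal σ} {a : DAct σ} {b : Bool}, p ∈ netStates A (M ++ N) →
      p₁ ∈ netStates A (M ++ N) → Flat A M p a b p₁ →
      (p₁.restrict X).override (p.restrict Y) = p₁ := fun hp hp₁ h =>
    restrict_override_restrict (fun _ _ => rfl)
      (fun x _ hx => (h.frame hMN.left.ax (domX hp) hx).symm) (domX hp₁) (dom_eq hp₁).subset
  have eq_right : ∀ {p₁ p₂ : PVal σ} {a : DAct σ} {b : Bool}, p₁ ∈ netStates A (M ++ N) →
      p₂ ∈ netStates A (M ++ N) → Flat A N p₁ a b p₂ →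
      (p₂.restrict Y).override (p₁.restrict X) = p₂ := fun hp hp₁ h =>
    restrict_override_restrict (fun _ _ => rfl)
      (fun x _ hx => (h.frame hMN.right.ax (domY hp) hx).symm) (domY hp₁)
      (Set.union_comm X Y ▸ (dom_eq hp₁).subset)
  have upd : ∀ {p p₁ : PVal σ} {a : DAct σ} {b : Bool}, p ∈ netStates A (M ++ N) →
      p₁ ∈ netStates A (M ++ N) → Flat A M p a b p₁ →
      (p.restrict Y).update (p₁.restrict X) = p₁.restrict Y := by
    intro p p₁ a b hp hp₁ h
    funext x
    by_cases hx : x ∈ X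
    · by_cases hy : x ∈ Y
      · rw [update_of_mem, restrict_of_mem _ hx, restrict_of_mem _ hy]
        · rw [dom_restrict]; exact ⟨domY hp hy, hy⟩
        · rw [dom_restrict]; exact ⟨domX hp₁ hx, hx⟩
      · rw [restrict_of_notMem _ hy, ← notMem_dom, dom_update, dom_restrict]
        exact fun h => hy h.2
    · rw [update_of_notMem (by rw [dom_restrict]; exact fun h => hx h.2)]
      by_cases hy : x ∈ Y
      · rw [restrict_of_mem _ hy, restrict_of_mem _ hy, h.frame hMN.left.ax (domX hp) hx]
      · rw [restrict_of_notMem _ hy, restrict_of_notMem _ hy]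
  have tr₁ : ∀ {p p₁ : PVal σ} {a : DAct σ} {b : Bool}, p ∈ netStates A (M ++ N) →
      p₁ ∈ netStates A (M ++ N) → Flat A M p a b p₁ →
      (a = .tau → b = true ∨ ∀ k ∈ M ++ N, ¬ (A k).Committed p) →
      T₁.Tr (p.restrict X) (.disc a) b (p₁.restrict X) := fun hp hp₁ h hc =>
    h₁.complete _ _ _ _ (netStates_left hp) (netStates_left hp₁)
      (h.restrict hMN.left.ax subset_rfl (domX hp))
      fun ha => (hc ha).imp_right fun hc k hk hk' => hc k (List.mem_append_left N hk)
        ((TA.Committed.congr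
          (restrict_of_mem _ (vars_subset_netVars hk (A k).loc_mem_vars))).1 hk')
  -- The second mover always performs an input, so the τ-proviso of `complete` is void for it.
  have tr₂ : ∀ {p p₁ : PVal σ} {a : DAct σ} {b : Bool}, p ∈ netStates A (M ++ N) →
      p₁ ∈ netStates A (M ++ N) → Flat A N p a b p₁ → a ≠ .tau →
      T₂.Tr (p.restrict Y) (.disc a) b (p₁.restrict Y) := fun hp hp₁ h hc =>
    h₂.complete _ _ _ _ (netStates_right hp) (netStates_right hp₁)
      (h.restrict hMN.right.ax subset_rfl (domY hp)) fun ha => absurd ha hc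
  have com₁ : T₁.Comm (q.restrict X) → ∃ k ∈ M ++ N, (A k).Committed q := fun h => by
    obtain ⟨k, hk, hk'⟩ := h₁.committed hMN.left h
    exact ⟨k, List.mem_append_left N hk, (TA.Committed.congr
      (restrict_of_mem _ (vars_subset_netVars hk (A k).loc_mem_vars))).1 hk'⟩
  have com₂ : T₂.Comm (q.restrict Y) → ∃ k ∈ M ++ N, (A k).Committed q := fun h => by
    obtain ⟨k, hk, hk'⟩ := h₂.committed hMN.right h
    exact ⟨k, List.mem_append_right M hk, (TA.Committed.congr
      (restrict_of_mem _ (vars_subset_netVars hk (A k).loc_mem_vars))).1 hk'⟩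
  have hr : q.restrict X ∈ T₁.S := h₁.states ▸ netStates_left hq
  have hs : q.restrict Y ∈ T₂.S := h₂.states ▸ netStates_right hq
  have hrs := restrict_compat_restrict q X Y
  cases h with
  | single a b q' hl h =>
    have htr := tr₁ hq hq' h hc
    have e₁ := eq_self hq
    have e₂ := eq_left hq hq' h
    cases a with
    | bsend => exact hl.elim
    | brecv => exact hl.elim
    | send c =>
      have := TTSB.ParRule.send _ _ _ c b hr hs hrs htr
      rwa [e₁, e₂] at this
    | recv c =>
      have := TTSB.ParRule.recv _ _ _ c b hr hs hrs htr
      rwa [e₁, e₂] at this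
    | tau =>
      -- If the move is uncommitted, `hc` excludes committed locations, hence also committed
      -- transitions of the partner.
      have := TTSB.ParRule.tau _ _ _ b hr hs hrs htr fun hC => (hc rfl).resolve_right fun hc => by
        obtain ⟨k, hk, hk'⟩ := com₂ hC
        exact hc k hk hk'
      rwa [e₁, e₂] at this
  | sync c b b' q₁ q' h h' =>
    have hq₁ := h.mid_mem_netStates h' hMN hq hq'
    have htr := tr₁ hq hq₁ h (nomatch ·)
    have htr' := tr₂ hq₁ hq' h' (nomatch ·)
    rw [← upd hq hq₁ h] at htr'
    have := TTSB.ParRule.sync _ _ _ _ c b b' hr hs hrs htr htr' fun hC =>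
      (hc rfl).resolve_right fun hc => by
        obtain ⟨k, hk, hk'⟩ := hC.elim com₁ com₂
        exact hc k hk hk'
    rwa [eq_self hq, eq_right hq₁ hq' h'] at this
  | bsend δ b b' q₁ q' h h' =>
    have hq₁ := h.mid_mem_netStates h' hMN hq hq'
    have htr := tr₁ hq hq₁ h (nomatch ·)
    have htr' := tr₂ hq₁ hq' h' (nomatch ·)
    rw [← upd hq hq₁ h] at htr'
    have := TTSB.ParRule.snd _ _ _ _ δ b b' hr hs hrs htr htr'
    rwa [eq_self hq, restrict_override_restrict (g := q') (fun x hx => ?_) (fun _ _ _ => rfl)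
      (domX hq₁) (dom_eq hq').subset] at this
    exact (h'.brecv_frame hMN.right.ax (domY hq₁) fun k hk hxk =>
      hMN.swap.own_notMem_left hk hxk hx).symm
  | brecv δ b b' q₁ q' h h' =>
    have hq₁ := h.mid_mem_netStates h' hMN hq hq'
    have htr := tr₁ hq hq₁ h (nomatch ·)
    have htr' := tr₂ hq₁ hq' h' (nomatch ·)
    -- In the reception rule both components move from the original state; the first reception has
    -- not changed any variable of the second group.
    have hqY : q₁.restrict Y = q.restrict Y := restrict_eq_restrict_iff.2 fun x hx =>
      h.brecv_frame hMN.left.ax (domX hq) fun k hk hxk => hMN.own_notMem_left hk hxk hx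
    rw [hqY] at htr'
    have := TTSB.ParRule.rcv _ _ _ _ δ b b' hr hs hrs htr htr'
    rwa [eq_self hq, restrict_override_restrict (g := q') (fun x hx => ?_) (fun _ _ _ => rfl)
      (domX hq₁) (dom_eq hq').subset] at this
    exact (h'.brecv_frame hMN.right.ax (domY hq₁) fun k hk hxk =>
      hMN.swap.own_notMem_left hk hxk hx).symm

theorem ParRule.time_sound {T₁ T₂ : TTSB σ} (h₁ : Represents A T₁ M) (h₂ : Represents A T₂ N)
    (hMN : Separated A (M ++ N)) {q q' : PVal σ} {d : ℝ≥0} {b : Bool}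
    (h : TTSB.ParRule T₁ T₂ q (.time d) b q') :
    q ∈ netStates A (M ++ N) ∧ q' ∈ netStates A (M ++ N) ∧ b = false ∧ q' = q.delay d ∧
      CanDelay A (M ++ N) q := by
  cases h with
  | time r s r' s' d hr hs hrs h h' =>
    obtain ⟨hr, hr', -, rfl, hd⟩ := (h₁.time _ _ _ _).1 h
    obtain ⟨hs, hs', -, rfl, hd'⟩ := (h₂.time _ _ _ _).1 h'
    refine ⟨override_mem_netStates hMN hr hs, override_mem_netStates hMN hr' hs', rfl,
      (delay_override r s d).symm, CanDelay.append.2 ⟨?_, ?_⟩⟩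
    · exact (CanDelay.congr fun x hx => override_of_mem s (netStates_dom hr ▸ hx)).2 hd
    · exact (CanDelay.congr fun x hx =>
        override_eq_right hrs (netStates_dom hs ▸ hx)).2 hd'

/-- Compositionality. The rules used in either order of the components correspond to the two
alternatives of `Flat.dec`. -/
theorem Represents.par {T₁ T₂ : TTSB σ} (h₁ : Represents A T₁ M) (h₂ : Represents A T₂ N)
    (hMN : Separated A (M ++ N)) : Represents A (T₁.par T₂) (M ++ N) where
  ext := by
    ext x
    simp [TTSB.par, h₁.ext, h₂.ext, or_and_right, exists_or]
  states := by
    ext q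
    constructor
    · rintro ⟨r, hr, s, hs, -, rfl⟩
      exact override_mem_netStates hMN (h₁.states ▸ hr) (h₂.states ▸ hs)
    · intro hq
      have hd := hq.1.trans (netVars_append M N)
      exact ⟨_, h₁.states ▸ netStates_left hq, _, h₂.states ▸ netStates_right hq,
        restrict_compat_restrict _ _ _, (restrict_override_restrict (fun _ _ => rfl)
          (fun _ _ _ => rfl) (hd ▸ Set.subset_union_left) hd.subset).symm⟩
  sound q a b q' h := by
    rcases h with h | h
    · obtain ⟨hq, hq', h⟩ := ParRule.sound h₁ h₂ hMN h
      exact ⟨hq, hq', h.flat hMN hq.1.symm.subset⟩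
    · obtain ⟨hq, hq', h⟩ := ParRule.sound h₂ h₁ hMN.swap h
      rw [netStates_append_comm] at hq hq'
      exact ⟨hq, hq', h.flat_swap hMN hq.1.symm.subset⟩
  complete q a b q' hq hq' h hc := by
    rcases h.dec hMN hq.1.symm.subset with h | h
    · exact .inl (ParRule.complete h₁ h₂ hMN hq hq' h hc)
    · refine .inr (ParRule.complete h₂ h₁ hMN.swap (netStates_append_comm ▸ hq)
        (netStates_append_comm ▸ hq') h fun ha => (hc ha).imp_right fun hc k hk =>
          hc k (List.perm_append_comm.subset hk))
  time q d b q' := by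
    constructor
    · rintro (h | h)
      · exact ParRule.time_sound h₁ h₂ hMN h
      · obtain ⟨hq, hq', hb, he, hd⟩ := ParRule.time_sound h₂ h₁ hMN.swap h
        rw [netStates_append_comm] at hq hq'
        exact ⟨hq, hq', hb, he, CanDelay.append.2 (CanDelay.append.1 hd).symm⟩
    · rintro ⟨hq, hq', rfl, rfl, hd⟩
      have hdq := hq.1.trans (netVars_append M N)
      have hdq' := hq'.1.trans (netVars_append M N)
      obtain ⟨hM, hN⟩ := CanDelay.append.1 hd
      have := TTSB.ParRule.time _ _ _ _ d (h₁.states ▸ netStates_left hq)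
        (h₂.states ▸ netStates_right hq) (restrict_compat_restrict _ _ _)
        ((h₁.time _ _ _ _).2 ⟨netStates_left hq, netStates_left hq', rfl,
          (delay_restrict q _ d).symm, CanDelay.restrict_iff.2 hM⟩)
        ((h₂.time _ _ _ _).2 ⟨netStates_right hq, netStates_right hq', rfl,
          (delay_restrict q _ d).symm, CanDelay.restrict_iff.2 hN⟩)
      rw [restrict_override_restrict (g := q) (fun _ _ => rfl) (fun _ _ _ => rfl)
          (hdq ▸ Set.subset_union_left) hdq.subset,
        restrict_override_restrict (g := q.delay d) (fun _ _ => rfl) (fun _ _ _ => rfl)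
          (hdq' ▸ Set.subset_union_left) hdq'.subset] at this
      exact .inl this

theorem netVars_singleton (k : σ.Name) : netVars A [k] = (A k).vars := by
  ext x
  simp [mem_netVars]

theorem mem_netStates_singleton {k : σ.Name} {q : PVal σ} :
    q ∈ netStates A [k] ↔ q ∈ Val (A k).vars ∧ (A k).InvHolds q := by
  simp only [netStates, netVars_singleton, List.mem_singleton, forall_eq]
  exact Iff.rfl

theorem others_singleton (k : σ.Name) : others [k] k = [] := by simp [others]

theorem Represents.toTTSB {k : σ.Name} : Represents A (A k).toTTSB [k] where
  ext := by
    ext x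
    simp [TA.toTTSB]
  states := by
    ext q
    rw [mem_netStates_singleton]
    exact Iff.rfl
  sound q a b q' h := by
    obtain ⟨hq, hq', h⟩ := h
    refine ⟨mem_netStates_singleton.2 hq, mem_netStates_singleton.2 hq', ?_⟩
    generalize hact : Act.disc a = act at h
    cases h with
    | act e b he hs hb =>
      cases hact
      have hk : k ∈ [k] := List.mem_singleton_self k
      cases ha : e.act with
      | bsend δ =>
        rw [← Bool.or_false b]
        exact .bsend q δ k e b false _ hk he ha hs hb
          (by rw [others_singleton]; exact .nil _)
      | brecv δ =>
        rw [← Bool.or_false b]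
        exact .brecv q δ _ _ (.cons k [] q _ _ b false (.take q e b he ha hs hb) (.nil _))
      | send c => exact .single q _ k e b hk he ha trivial hs hb
      | recv c => exact .single q _ k e b hk he ha trivial hs hb
      | tau => exact .single q _ k e b hk he ha trivial hs hb
    | time => cases hact
    | virt δ h =>
      cases hact
      exact .brecv q δ _ _ (.cons k [] q _ _ false false (.skip q h) (.nil _))
  complete q a b q' hq hq' h _ := by
    refine ⟨mem_netStates_singleton.1 hq, mem_netStates_singleton.1 hq', ?_⟩
    cases h with
    | single a i e b hi he ha hl hs hb =>
      obtain rfl := List.mem_singleton.1 hi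
      exact ha ▸ .act q e b he hs hb
    | sync c i j e f b b' hi hj hij =>
      exact absurd ((List.mem_singleton.1 hi).trans (List.mem_singleton.1 hj).symm) hij
    | bsend δ i e b b' q' hi he ha hs hb h =>
      obtain rfl := List.mem_singleton.1 hi
      rw [others_singleton] at h
      cases h
      rw [← ha, Bool.or_false]
      exact .act q e b he hs hb
    | brecv δ b q' h =>
      cases h with
      | cons _ _ _ q₁ _ b b' h h' =>
        cases h'
        rw [Bool.or_false]
        cases h with
        | take e _ he ha hs hb => exact ha ▸ .act q e b he hs hb
        | skip h => exact .virt q δ h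
  time q d b q' := by
    rw [mem_netStates_singleton, mem_netStates_singleton]
    constructor
    · rintro ⟨hq, hq', h⟩
      refine ⟨hq, hq', ?_⟩
      cases h with
      | time _ hc hu => exact ⟨rfl, rfl, by simpa [CanDelay] using ⟨hc, hu⟩⟩
    · rintro ⟨hq, hq', rfl, rfl, hd⟩
      obtain ⟨hc, hu⟩ : ¬ (A k).Committed q ∧ ¬ (A k).UrgentEnabled q := by
        simpa [CanDelay] using hd
      exact ⟨hq, hq', .time q d hc hu⟩

theorem netTTSB_append_singleton (hN : N ≠ []) (k : σ.Name) :
    netTTSB A (N ++ [k]) = (netTTSB A N).par (A k).toTTSB := by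
  cases N with
  | nil => exact absurd rfl hN
  | cons j N => simp [netTTSB]

theorem represents_netTTSB (hN : Separated A N) (h0 : N ≠ []) :
    Represents A (netTTSB A N) N := by
  induction N using List.reverseRecOn with
  | nil => exact absurd rfl h0
  | append_singleton N k ih =>
    rcases eq_or_ne N [] with rfl | h
    · exact Represents.toTTSB
    · rw [netTTSB_append_singleton h]
      exact (ih hN.left h).par .toTTSB hN

end Represents

/-! ### Initial states of networks and of compositions. -/

section Init

variable {σ : Sig} {A : (k : σ.Name) → TA σ k} {M N : List σ.Name}

variable (A) in
/-- The merge of the initial valuations and initial locations of the listed automata. -/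
structure IsInit (N : List σ.Name) (f : PVal σ) : Prop where
  dom : f.dom = netVars A N
  val : ∀ k ∈ N, ∀ x ∈ (A k).V, f x = (A k).v0 x
  loc : ∀ k ∈ N, f (.loc k) = some (A k).l0

/-- Initial states are built by different folds; comparing them through their values avoids
manipulating the folds. -/
theorem IsInit.unique {f g : PVal σ} (hf : IsInit A N f) (hg : IsInit A N g) : f = g := by
  funext x
  by_cases hx : x ∈ netVars A N
  · obtain ⟨k, hk, hx | rfl⟩ := hx
    · rw [hf.val k hk x hx, hg.val k hk x hx]
    · rw [hf.loc k hk, hg.loc k hk]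
  · have hxf : x ∉ f.dom := hf.dom ▸ hx
    have hxg : x ∉ g.dom := hg.dom ▸ hx
    rw [notMem_dom.1 hxf, notMem_dom.1 hxg]

theorem IsInit.restrict {f : PVal σ} (hf : IsInit A N f) (hMN : M ⊆ N) :
    IsInit A M (f.restrict (netVars A M)) where
  dom := restrict_mem_Val (hf.dom ▸ netVars_mono hMN)
  val k hk x hx := by
    rw [restrict_of_mem _ (vars_subset_netVars hk (Or.inl hx)), hf.val k (hMN hk) x hx]
  loc k hk := by
    rw [restrict_of_mem _ (vars_subset_netVars hk (A k).loc_mem_vars), hf.loc k (hMN hk)]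

theorem IsInit.mem_netStates {f : PVal σ} (hf : IsInit A N f) : f ∈ netStates A N := by
  refine ⟨hf.dom, fun k hk => ⟨_, hf.loc k hk, ?_⟩⟩
  have : f.restrict (A k).V = (A k).v0 := by
    rw [restrict_eq_restrict_iff.2 (hf.val k hk), restrict_eq_self (X := (A k).V) (A k).v0_mem.subset]
  rw [Holds, this]
  exact (A k).inv_init

theorem dom_v0 (k : σ.Name) : (A k).v0.dom = (A k).V := (A k).v0_mem

theorem mem_dom_foldr_override (g : σ.Name → PVal σ) (N : List σ.Name) (x : Var σ) :
    x ∈ (N.foldr (fun k f => (g k).override f) PVal.empty).dom ↔ ∃ k ∈ N, x ∈ (g k).dom := by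
  induction N with
  | nil => simp [mem_dom, PVal.empty]
  | cons k N ih => simp [dom_override, ih]

/-- Pairwise compatibility makes the precedence among the overridden valuations irrelevant. -/
theorem foldr_override_eq (g : σ.Name → PVal σ) (N : List σ.Name)
    (hg : ∀ k ∈ N, ∀ j ∈ N, (g k).Compat (g j)) {k : σ.Name} (hk : k ∈ N) {x : Var σ}
    (hx : x ∈ (g k).dom) : N.foldr (fun k f => (g k).override f) PVal.empty x = g k x := by
  induction N with
  | nil => cases hk
  | cons j N ih =>
    rw [List.foldr_cons]
    by_cases hj : x ∈ (g j).dom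
    · rw [override_of_mem _ hj, hg j List.mem_cons_self k hk x ⟨hj, hx⟩]
    · rw [override_of_notMem _ hj]
      refine ih (fun k hk j hj => hg k (List.mem_cons_of_mem _ hk) j (List.mem_cons_of_mem _ hj)) ?_
      rcases List.mem_cons.1 hk with rfl | hk
      · exact absurd hx hj
      · exact hk

theorem IsNTA.compat_v0 (hN : IsNTA A N) {k j : σ.Name} (hk : k ∈ N) (hj : j ∈ N) :
    (A k).v0.Compat (A j).v0 := by
  rcases eq_or_ne k j with rfl | h
  · exact fun _ _ => rfl
  · exact (hN.2 k hk j hj h).2.2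

theorem isInit_netInit (hN : IsNTA A N) : IsInit A N (netInit A N) := by
  have hl : ∀ k j : σ.Name, (PVal.single k (A k).l0).Compat (PVal.single j (A j).l0) := by
    rintro k j x ⟨hx, hx'⟩
    rw [dom_single] at hx hx'
    obtain rfl := hx
    obtain rfl := Var.loc.inj hx'
    rfl
  refine ⟨?_, fun k hk x hx => ?_, fun k hk => ?_⟩
  · ext x
    simp only [netInit, dom_override, Set.mem_union, mem_netVars,
      mem_dom_foldr_override (fun k => (A k).v0),
      mem_dom_foldr_override (fun k => PVal.single k (A k).l0), dom_v0, dom_single, TA.vars]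
    simp only [← exists_or, ← and_or_left]
  · have hx' : x ∈ (A k).v0.dom := (dom_v0 k).symm ▸ hx
    rw [netInit, override_of_mem]
    · exact foldr_override_eq (fun k => (A k).v0) N (fun k hk j hj => hN.compat_v0 hk hj) hk hx'
    · exact (mem_dom_foldr_override (fun k => (A k).v0) N x).2 ⟨k, hk, hx'⟩
  · rw [netInit, override_of_notMem]
    · rw [foldr_override_eq (fun k => PVal.single k (A k).l0) N (fun k _ j _ => hl k j) hk
        ((dom_single k _).symm ▸ rfl), single_self]
    · rw [mem_dom_foldr_override (fun k => (A k).v0)]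
      rintro ⟨j, -, hj⟩
      exact (A j).loc_notMem_V k (dom_v0 j ▸ hj)

theorem isInit_toTTSB (k : σ.Name) : IsInit A [k] (A k).toTTSB.s0 := by
  refine ⟨?_, fun j hj x hx => ?_, fun j hj => ?_⟩
  · rw [netVars_singleton]
    change ((A k).v0.override (PVal.single k (A k).l0)).dom = _
    rw [dom_override, dom_v0, dom_single]
    rfl
  · obtain rfl := List.mem_singleton.1 hj
    exact override_of_mem _ ((dom_v0 j).symm ▸ hx)
  · obtain rfl := List.mem_singleton.1 hj
    exact (override_of_notMem _ fun h => (A j).loc_notMem_V j (dom_v0 j ▸ h)).trans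
      (single_self j _)

theorem IsInit.append {f g : PVal σ} (hMN : IsNTA A (M ++ N)) (hf : IsInit A M f)
    (hg : IsInit A N g) : IsInit A (M ++ N) (f.override g) := by
  refine ⟨by rw [dom_override, hf.dom, hg.dom, netVars_append], fun k hk x hx => ?_,
    fun k hk => ?_⟩
  · by_cases hxf : x ∈ f.dom
    · rw [override_of_mem _ hxf]
      obtain ⟨j, hj, hxj | rfl⟩ := hf.dom ▸ hxf
      · rw [hf.val j hj x hxj]
        exact hMN.compat_v0 (List.mem_append_left N hj) hk x
          ⟨(dom_v0 j).symm ▸ hxj, (dom_v0 k).symm ▸ hx⟩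
      · exact absurd hx ((A k).loc_notMem_V j)
    · rw [override_of_notMem _ hxf]
      rcases List.mem_append.1 hk with hk | hk
      · exact absurd (hf.dom ▸ vars_subset_netVars hk (Or.inl hx)) hxf
      · exact hg.val k hk x hx
  · rcases List.mem_append.1 hk with hk | hk
    · rw [override_of_mem _ (hf.dom ▸ vars_subset_netVars hk (A k).loc_mem_vars), hf.loc k hk]
    · rw [override_of_notMem, hg.loc k hk]
      rw [hf.dom]
      rintro ⟨j, hj, hx | hx⟩
      · exact (A j).loc_notMem_V k hx
      · exact List.disjoint_of_nodup_append hMN.1 (Var.loc.inj hx ▸ hj) hk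

theorem IsNTA.left (h : IsNTA A (M ++ N)) : IsNTA A M :=
  ⟨h.1.of_append_left, fun k hk j hj => h.2 k (List.mem_append_left N hk) j
    (List.mem_append_left N hj)⟩

theorem isInit_netTTSB (hN : IsNTA A N) (h0 : N ≠ []) : IsInit A N (netTTSB A N).s0 := by
  induction N using List.reverseRecOn with
  | nil => exact absurd rfl h0
  | append_singleton N k ih =>
    rcases eq_or_ne N [] with rfl | h
    · exact isInit_toTTSB k
    · rw [netTTSB_append_singleton h]
      exact (ih hN.left h).append hN (isInit_toTTSB k)

end Init

/-! ### Steps of the network semantics versus joint moves. -/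

section NetRule

variable {σ : Sig} {A : (k : σ.Name) → TA σ k} {N L : List σ.Name}

variable (A) in
/-- The automaton `j` can receive a broadcast on `δ` in `s`. -/
def CanReceive (δ : σ.Bcast) (s : PVal σ) (j : σ.Name) : Prop :=
  ∃ e ∈ (A j).edges, e.act = .brecv δ ∧ (A j).Enabled e s

variable (A) in
/-- The state after the listed automata that can receive on `δ` in `s` have moved from `q`. -/
noncomputable def receiveAll (δ : σ.Bcast) (s : PVal σ) (f : (j : σ.Name) → Edge σ j)
    (L : List σ.Name) (q : PVal σ) : PVal σ :=
  open scoped Classical in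
  (L.filter fun j => CanReceive A δ s j).foldl (fun t j => (A j).apply (f j) t) q

theorem receiveAll_cons_pos {δ : σ.Bcast} {s : PVal σ} {j : σ.Name} (h : CanReceive A δ s j)
    (f : (j : σ.Name) → Edge σ j) (L : List σ.Name) (q : PVal σ) :
    receiveAll A δ s f (j :: L) q = receiveAll A δ s f L ((A j).apply (f j) q) := by
  simp [receiveAll, h]

theorem receiveAll_cons_neg {δ : σ.Bcast} {s : PVal σ} {j : σ.Name} (h : ¬ CanReceive A δ s j)
    (f : (j : σ.Name) → Edge σ j) (L : List σ.Name) (q : PVal σ) :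
    receiveAll A δ s f (j :: L) q = receiveAll A δ s f L q := by
  simp [receiveAll, h]

theorem receiveAll_congr {δ : σ.Bcast} {s : PVal σ} {f g : (j : σ.Name) → Edge σ j}
    (L : List σ.Name) (h : ∀ j ∈ L, f j = g j) (q : PVal σ) :
    receiveAll A δ s f L q = receiveAll A δ s g L q := by
  induction L generalizing q with
  | nil => rfl
  | cons j L ih =>
    rw [List.forall_mem_cons] at h
    by_cases hj : CanReceive A δ s j
    · rw [receiveAll_cons_pos hj, receiveAll_cons_pos hj, h.1, ih h.2]
    · rw [receiveAll_cons_neg hj, receiveAll_cons_neg hj, ih h.2]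

theorem mem_RS {δ : σ.Bcast} {i j : σ.Name} {s : PVal σ} :
    j ∈ RS A N δ i s ↔ j ∈ others N i ∧ CanReceive A δ s j := by
  rw [mem_others, and_assoc]
  exact Iff.rfl

theorem bcastTarget_eq (δ : σ.Bcast) (i : σ.Name) (e : Edge σ i) (f : (j : σ.Name) → Edge σ j)
    (s : PVal σ) :
    bcastTarget A N δ i e f s = receiveAll A δ s f (others N i) ((A i).apply e s) := by
  classical
  rw [bcastTarget, receiveAll, others, List.filter_filter]
  congr 1
  refine List.filter_congr fun j hj => ?_
  rw [← Bool.decide_and, decide_eq_decide, mem_RS, mem_others]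
  tauto

/-- Here `s` is the state in which the network evaluates guards and `q` the running valuation. They
agree on the internal variables of all automata still to move, which is preserved by each reception
and is all that input guards can see. -/
theorem rcv_receiveAll {δ : σ.Bcast} {s q : PVal σ} {f : (j : σ.Name) → Edge σ j}
    (hL : Separated A L) (hs : netVars A L ⊆ s.dom) (hq : netVars A L ⊆ q.dom)
    (hsq : ∀ j ∈ L, ∀ x ∈ (A j).own, s x = q x)
    (hf : ∀ j ∈ L, CanReceive A δ s j →
      f j ∈ (A j).edges ∧ (f j).act = .brecv δ ∧ (A j).Enabled (f j) s) :
    ∃ b, Rcv A δ L q b (receiveAll A δ s f L q) ∧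
      ∀ j ∈ L, CanReceive A δ s j → (f j).src ∈ (A j).K → b = true := by
  induction L generalizing q with
  | nil => exact ⟨false, .nil q, nofun⟩
  | cons k L ih =>
    have hs' := netVars_cons_subset hs
    have hq' := netVars_cons_subset hq
    have hk := hL.ax k List.mem_cons_self
    rw [List.forall_mem_cons] at hf hsq
    have en : ∀ e ∈ (A k).edges, e.act = .brecv δ → ((A k).Enabled e s ↔ (A k).Enabled e q) :=
      fun e he ha => TA.Enabled.congr_own hk he (.inl ⟨δ, ha⟩) hs'.1 hq'.1 hsq.1
    by_cases hr : CanReceive A δ s k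
    · rw [receiveAll_cons_pos hr]
      obtain ⟨he, ha, hen⟩ := hf.1 hr
      classical
      have h₁ : RcvOne A δ k q (decide ((f k).src ∈ (A k).K)) ((A k).apply (f k) q) :=
        .take q (f k) _ he ha ((en _ he ha).1 hen) (by simp)
      obtain ⟨b, hb, hb'⟩ := ih (q := (A k).apply (f k) q) hL.of_cons hs'.2 (h₁.dom ▸ hq'.2)
        (fun j hj x hx => by
          rw [hsq.2 j hj x hx, h₁.frame hk hq'.1 fun hx' => hL.own j (List.mem_cons_of_mem k hj) k
            List.mem_cons_self ?_ x hx ((A k).own_subset_vars hx')]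
          rintro rfl
          exact (List.nodup_cons.1 hL.nodup).1 hj) hf.2
      refine ⟨_, .cons k L q _ _ _ b h₁ hb, ?_⟩
      rw [List.forall_mem_cons]
      exact ⟨fun _ h => by simp [h], fun j hj hr hK => by simp [hb' j hj hr hK]⟩
    · rw [receiveAll_cons_neg hr]
      obtain ⟨b, hb, hb'⟩ := ih hL.of_cons hs'.2 hq'.2 hsq.2 hf.2
      refine ⟨_, .cons k L q q _ false b (.skip q fun e he ha hen =>
        hr ⟨e, he, ha, (en e he ha).2 hen⟩) hb, ?_⟩
      rw [List.forall_mem_cons]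
      exact ⟨fun h => absurd h hr, fun j hj hr hK => by simp [hb' j hj hr hK]⟩

/-- The choice function collects the transitions taken along `Rcv`; where an automaton ignored the
broadcast, no transition is enabled in `s` either. -/
theorem Rcv.exists_receiveAll {δ : σ.Bcast} {s q q' : PVal σ} {b : Bool}
    (h : Rcv A δ L q b q') (hL : Separated A L) (hs : netVars A L ⊆ s.dom)
    (hq : netVars A L ⊆ q.dom) (hsq : ∀ j ∈ L, ∀ x ∈ (A j).own, s x = q x) :
    ∃ f : (j : σ.Name) → Edge σ j, (∀ j ∈ L, CanReceive A δ s j →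
      f j ∈ (A j).edges ∧ (f j).act = .brecv δ ∧ (A j).Enabled (f j) s) ∧
      q' = receiveAll A δ s f L q ∧
      (b = true → ∃ j ∈ L, CanReceive A δ s j ∧ (f j).src ∈ (A j).K) := by
  induction h with
  | nil q =>
    -- The choice function must be total, so a dummy transition is used for automata that do not
    -- receive.
    exact ⟨fun j => ⟨(A j).l0, ∅, .tau, id, (A j).l0⟩, nofun, rfl, nofun⟩
  | cons k L q q₁ q' b b' h _ ih =>
    have hs' := netVars_cons_subset hs
    have hq' := netVars_cons_subset hq
    have hk := hL.ax k List.mem_cons_self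
    have hkL := (List.nodup_cons.1 hL.nodup).1
    rw [List.forall_mem_cons] at hsq
    have en : ∀ e ∈ (A k).edges, e.act = .brecv δ → ((A k).Enabled e s ↔ (A k).Enabled e q) :=
      fun e he ha => TA.Enabled.congr_own hk he (.inl ⟨δ, ha⟩) hs'.1 hq'.1 hsq.1
    obtain ⟨f, hf, rfl, hb⟩ := ih hL.of_cons hs'.2 (h.dom ▸ hq'.2) fun j hj x hx => by
      rw [hsq.2 j hj x hx, h.frame hk hq'.1 fun hx' => hL.own j (List.mem_cons_of_mem k hj) k
        List.mem_cons_self ?_ x hx ((A k).own_subset_vars hx')]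
      rintro rfl
      exact hkL hj
    cases h with
    | take e _ he ha hen hbe =>
      have hen' := (en e he ha).2 hen
      have hr : CanReceive A δ s k := ⟨e, he, ha, hen'⟩
      classical
      -- Names do not repeat, so fixing the choice for `k` leaves those for the tail untouched.
      have hne : ∀ j ∈ L, Function.update f k e j = f j := fun j hj =>
        Function.update_of_ne (by rintro rfl; exact hkL hj) _ _
      refine ⟨Function.update f k e, ?_, ?_, ?_⟩
      · rw [List.forall_mem_cons, Function.update_self]
        exact ⟨fun _ => ⟨he, ha, hen'⟩, fun j hj => hne j hj ▸ hf j hj⟩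
      · rw [receiveAll_cons_pos hr, Function.update_self, receiveAll_congr L hne]
      · intro hbb
        rcases Bool.or_eq_true_iff.1 hbb with h | h
        · exact ⟨k, List.mem_cons_self, hr, by rw [Function.update_self]; exact hbe.1 h⟩
        · obtain ⟨j, hj, hrj, hK⟩ := hb h
          exact ⟨j, List.mem_cons_of_mem k hj, hrj, by rw [hne j hj]; exact hK⟩
    | skip hn =>
      have hr : ¬ CanReceive A δ s k := fun ⟨e, he, ha, hen⟩ => hn e he ha ((en e he ha).1 hen)
      refine ⟨f, ?_, ?_, fun hbb => ?_⟩
      · rw [List.forall_mem_cons]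
        exact ⟨fun h => absurd h hr, hf⟩
      · rw [receiveAll_cons_neg hr]
      · obtain ⟨j, hj, h⟩ := hb (by simpa using hbb)
        exact ⟨j, List.mem_cons_of_mem k hj, h⟩

/-- The actions of transitions that are discrete steps of a closed network. -/
def DAct.IsStep : DAct σ → Prop
  | .tau => True
  | .bsend _ => True
  | _ => False

theorem Separated.own_apply (hN : Separated A N) {q : PVal σ} (hq : netVars A N ⊆ q.dom)
    {i : σ.Name} (hi : i ∈ N) {e : Edge σ i} (he : e ∈ (A i).edges) :
    ∀ j ∈ _root_.others N i, ∀ x ∈ (A j).own, q x = (A i).apply e q x := fun j hj x hx =>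
  (TA.apply_of_notMem_vars he ((vars_subset_netVars hi).trans hq)
    (hN.own j (mem_others.1 hj).1 i hi (mem_others.1 hj).2 x hx)).symm

theorem Flat.netRule {q q' : PVal σ} {a : DAct σ} {b : Bool} (h : Flat A N q a b q')
    (hN : Separated A N) (hq : netVars A N ⊆ q.dom) (ha : a.IsStep)
    (hc : b = true ∨ ∀ k ∈ N, ¬ (A k).Committed q) : NetRule A N q (.disc .tau) q' := by
  cases h with
  | single a i e b hi he hae hl hs hb =>
    cases a with
    | tau => exact .tau q i e hi he hae hs (hc.symm.imp_right hb.1)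
    | _ => first | exact ha.elim | exact hl.elim
  | sync c i j e f b b' hi hj hij he hae hse hf haf hsf hb hb' =>
    refine .sync q c i j e f hi hj hij he hae hse hf haf hsf (hc.symm.imp_right fun h => ?_)
    exact (Bool.or_eq_true_iff.1 h).imp hb.1 hb'.1
  | bsend δ i e b b' q' hi he hae hs hb h =>
    have hq' := (netVars_mono (A := A) (others_subset N i)).trans hq
    obtain ⟨f, hf, rfl, hbf⟩ := h.exists_receiveAll (s := q) (hN.others i) hq'
      (TA.dom_apply e q ▸ hq') (hN.own_apply hq hi he)
    rw [← bcastTarget_eq]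
    refine .bcst q δ i e f hi he hae hs (fun j hj => ?_) (hc.symm.imp_right fun h => ?_)
    · exact hf j (mem_RS.1 hj).1 (mem_RS.1 hj).2
    · refine (Bool.or_eq_true_iff.1 h).imp hb.1 fun h => ?_
      obtain ⟨j, hj, hr, hK⟩ := hbf h
      exact ⟨j, mem_RS.2 ⟨hj, hr⟩, hK⟩
  | brecv => exact ha.elim

/-- The network labels a broadcast by τ; the existential action `a` recovers whether the joint move
was internal or a broadcast. -/
theorem NetRule.flat {q q' : PVal σ} {act : DAct σ} (h : NetRule A N q (.disc act) q')
    (hN : Separated A N) (hq : netVars A N ⊆ q.dom) :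
    act = .tau ∧ ∃ a b, a.IsStep ∧ Flat A N q a b q' ∧
      (b = true ∨ ∀ k ∈ N, ¬ (A k).Committed q) := by
  classical
  cases h with
  | tau i e hi he ha hs hc =>
    exact ⟨rfl, .tau, decide (e.src ∈ (A i).K), trivial,
      .single q _ i e _ hi he ha trivial hs (by simp), by simpa [or_comm] using hc⟩
  | sync c i j e f hi hj hij he hae hse hf haf hsf hc =>
    refine ⟨rfl, .tau, decide (e.src ∈ (A i).K) || decide (f.src ∈ (A j).K), trivial,
      .sync q c i j e f _ _ hi hj hij he hae hse hf haf hsf (by simp) (by simp), ?_⟩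
    simpa [or_comm] using hc.symm
  | bcst δ i e f hi he hae hse hf hc =>
    have hq' := (netVars_mono (A := A) (others_subset N i)).trans hq
    obtain ⟨b, hb, hbK⟩ := rcv_receiveAll (s := q) (f := f) (δ := δ) (hN.others i) hq'
      ((TA.dom_apply e q).symm ▸ hq') (hN.own_apply hq hi he)
      fun j hj hr => hf j (mem_RS.2 ⟨hj, hr⟩)
    rw [bcastTarget_eq]
    refine ⟨rfl, .bsend δ, _, trivial, .bsend q δ i e (decide (e.src ∈ (A i).K)) b _ hi he hae
      hse (by simp) hb, hc.symm.imp_left fun h => ?_⟩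
    rcases h with h | ⟨j, hj, hK⟩
    · simp [h]
    · simp [hbK j (mem_RS.1 hj).1 (mem_RS.1 hj).2 hK]

end NetRule

/-! ### The simulation between the concrete and the abstract network. -/

section Simulation

variable {σ : Sig} {A : (k : σ.Name) → TA σ k} {M N : List σ.Name}

theorem mem_netStates_append {p : PVal σ} (hp : p.dom = netVars A (M ++ N))
    (hM : p.restrict (netVars A M) ∈ netStates A M)
    (hN : p.restrict (netVars A N) ∈ netStates A N) : p ∈ netStates A (M ++ N) := by
  refine ⟨hp, fun k hk => ?_⟩
  rcases List.mem_append.1 hk with hk | hk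
  · exact (TA.InvHolds.congr_vars fun x hx =>
      restrict_of_mem p (vars_subset_netVars hk hx)).1 (hM.2 k hk)
  · exact (TA.InvHolds.congr_vars fun x hx =>
      restrict_of_mem p (vars_subset_netVars hk hx)).1 (hN.2 k hk)

theorem committed_restrict_iff {k : σ.Name} (hk : k ∈ N) {q : PVal σ} :
    (A k).Committed (q.restrict (netVars A N)) ↔ (A k).Committed q :=
  TA.Committed.congr (restrict_of_mem q (vars_subset_netVars hk (A k).loc_mem_vars))

theorem Separated.mem_E_of_mem_netVars (h : Separated A (M ++ N)) {x : Var σ}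
    (hM : x ∈ netVars A M) (hN : x ∈ netVars A N) : ∃ k ∈ M, x ∈ (A k).E := by
  obtain ⟨k, hk, hx⟩ := hM
  exact ⟨k, hk, TA.mem_E_of_notMem_own hx fun hx' => h.own_notMem_left hk hx' hN⟩

variable (A) in
/-- The data of an abstraction of the automata `as` by the automata `bs`, in the context of the
automata `cs`, where `R` is a timed step simulation for the channels in `Chan`. -/
structure Abstraction (as bs cs : List σ.Name) (Chan : Set (σ.Bcast ⊕ σ.Bin)) (Na Nb Tc : TTSB σ)
    (R : PVal σ → PVal σ → Prop) : Prop where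
  sep_a : Separated A (as ++ cs)
  sep_b : Separated A (bs ++ cs)
  rep_a : Represents A Na as
  rep_b : Represents A Nb bs
  rep_c : Represents A Tc cs
  used : Tc.used ⊆ Chan
  comparable : (Na.restrict Chanᶜ (localExt A as cs)).Comparable
    (Nb.restrict Chanᶜ (localExt A as cs))
  sim : TTSB.IsTimedStepSimulation (Na.restrict Chanᶜ (localExt A as cs))
    (Nb.restrict Chanᶜ (localExt A as cs)) R
  urgent : (∃ k ∈ as, (A k).urgent.Nonempty) →
    ∀ s ∈ netStates A bs, (∃ k ∈ bs, (A k).Committed s) →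
      (Nb.restrict Chanᶜ (localExt A as cs)).Comm s

variable (A) in
/-- The states `q` and `p` of the two networks agree on the common automata `cs`, and the states of
the other automata are related by `R`. -/
structure Related (as bs cs : List σ.Name) (R : PVal σ → PVal σ → Prop) (q p : PVal σ) :
    Prop where
  left : q ∈ netStates A (as ++ cs)
  right : p ∈ netStates A (bs ++ cs)
  rel : R (q.restrict (netVars A as)) (p.restrict (netVars A bs))
  agree : ∀ x ∈ netVars A cs, q x = p x

namespace Abstraction

variable {as bs cs : List σ.Name} {Chan : Set (σ.Bcast ⊕ σ.Bin)} {Na Nb Tc : TTSB σ}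
  {R : PVal σ → PVal σ → Prop} {q p q₁ : PVal σ} {a : DAct σ} {b : Bool}

/-- A variable shared with `cs` cannot be internal in `as`, and `localExt` hides precisely the
external ones that are not shared. -/
theorem mem_shared_iff_left (h : Abstraction A as bs cs Chan Na Nb Tc R) {x : Var σ} :
    x ∈ (Na.restrict Chanᶜ (localExt A as cs)).E ↔ x ∈ netVars A as ∧ x ∈ netVars A cs := by
  simp only [TTSB.restrict, h.rep_a.ext, localExt, Set.mem_sdiff, Set.mem_ofPred_eq]
  constructor
  · rintro ⟨⟨k, hk, hx⟩, hn⟩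
    refine ⟨⟨k, hk, Or.inl (Or.inl hx)⟩, ?_⟩
    by_contra hc
    exact hn ⟨⟨k, hk, hx⟩, hc⟩
  · rintro ⟨ha, hc⟩
    exact ⟨h.sep_a.mem_E_of_mem_netVars ha hc, fun hn => hn.2 hc⟩

/-- Comparability forces the abstract automata to share the same variables with `cs`, so updates by
`cs` reach both sides of `R` equally. -/
theorem mem_shared_iff_right (h : Abstraction A as bs cs Chan Na Nb Tc R) {x : Var σ} :
    x ∈ (Na.restrict Chanᶜ (localExt A as cs)).E ↔ x ∈ netVars A bs ∧ x ∈ netVars A cs := by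
  constructor
  · intro hx
    refine ⟨?_, (h.mem_shared_iff_left.1 hx).2⟩
    have hx' : x ∈ Nb.E := (h.comparable ▸ hx :).1
    rw [h.rep_b.ext] at hx'
    obtain ⟨k, hk, hx'⟩ := hx'
    exact ⟨k, hk, Or.inl (Or.inl hx')⟩
  · rintro ⟨hb, hc⟩
    rw [h.comparable]
    refine ⟨?_, fun hn => hn.2 hc⟩
    rw [h.rep_b.ext]
    exact h.sep_b.mem_E_of_mem_netVars hb hc

theorem comm_committed (h : Abstraction A as bs cs Chan Na Nb Tc R) {r : PVal σ}
    (hr : (Na.restrict Chanᶜ (localExt A as cs)).Comm r) : ∃ k ∈ as, (A k).Committed r := by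
  obtain ⟨a, t, ⟨ht, -⟩ | ⟨-, -, a', -, ht⟩⟩ := hr
  · exact h.rep_a.committed h.sep_a.left ⟨a, t, ht⟩
  · exact h.rep_a.committed h.sep_a.left ⟨a', t, ht⟩

/-- If no concrete automaton is in a committed location, neither is an abstract one. -/
theorem not_committed (h : Abstraction A as bs cs Chan Na Nb Tc R) {r s : PVal σ} (hrs : R r s)
    (hr : ∀ k ∈ as, ¬ (A k).Committed r) : ∀ k ∈ bs, ¬ (A k).Committed s := by
  obtain ⟨hrS, hsS⟩ := h.sim.subset r s hrs
  by_cases hu : ∃ k ∈ as, (A k).urgent.Nonempty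
  · intro k hk hc
    obtain ⟨j, hj, hj'⟩ := h.comm_committed (h.sim.comm r s hrs
      (h.urgent hu s (h.rep_b.states ▸ hsS) ⟨k, hk, hc⟩))
    exact hr j hj hj'
  · have hrS' : r ∈ netStates A as := h.rep_a.states ▸ hrS
    -- A delay of length 0 serves as a probe: it is possible in `r`, and `s` can answer it only if
    -- no abstract automaton is in a committed location.
    have ht : Na.Tr r (.time 0) false r := (h.rep_a.time _ _ _ _).2
      ⟨hrS', hrS', rfl, (delay_zero r).symm, hr, fun k hk ⟨e, he, _⟩ => hu ⟨k, hk, e, he⟩⟩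
    rcases h.sim.step r s hrs (.time 0) false r
      (.inl ⟨ht, by simp [TTSB.removed], by simp [TTSB.hidden]⟩) with ⟨s', hs', -⟩ | ⟨h0, -⟩
    · rcases hs' with ⟨hs', -⟩ | ⟨h0, -⟩
      · exact ((h.rep_b.time _ _ _ _).1 hs').2.2.2.2.1
      · cases h0
    · cases h0

theorem related_not_committed (h : Abstraction A as bs cs Chan Na Nb Tc R)
    (hqp : Related A as bs cs R q p) (hq : ∀ k ∈ as ++ cs, ¬ (A k).Committed q) :
    ∀ k ∈ bs ++ cs, ¬ (A k).Committed p := by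
  rw [List.forall_mem_append] at hq ⊢
  refine ⟨fun k hk => ?_, fun k hk => ?_⟩
  · rw [← committed_restrict_iff hk]
    exact h.not_committed hqp.rel (fun k hk => (committed_restrict_iff hk).not.2 (hq.1 k hk)) k hk
  · exact (TA.Committed.congr
      (hqp.agree _ (vars_subset_netVars hk (A k).loc_mem_vars))).not.1 (hq.2 k hk)

/-- The common automata make the same moves in related states. -/
theorem step_common (h : Abstraction A as bs cs Chan Na Nb Tc R)
    (hqp : Related A as bs cs R q p) (hs : Flat A cs q a b q₁)
    (hq₁ : q₁ ∈ netStates A (as ++ cs)) :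
    ∃ p₁, Flat A cs p a b p₁ ∧ Related A as bs cs R q₁ p₁ := by
  have hqc : netVars A cs ⊆ q.dom :=
    hqp.left.1 ▸ netVars_mono (List.subset_append_right as cs)
  have hpc : netVars A cs ⊆ p.dom :=
    hqp.right.1 ▸ netVars_mono (List.subset_append_right bs cs)
  have hs' : Flat A cs p a b (splice (netVars A cs) q₁ p) :=
    hs.transfer h.sep_a.right.ax subset_rfl hqc hpc hqp.agree (fun x hx => splice_of_mem _ _ hx)
      fun x hx => splice_of_notMem _ _ hx
  set X := (Na.restrict Chanᶜ (localExt A as cs)).E with hX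
  have hq₁X : X ⊆ q₁.dom := fun x hx => hq₁.1 ▸
    netVars_mono (List.subset_append_left as cs) (h.mem_shared_iff_left.1 hx).1
  have hqa : netVars A as ⊆ q.dom := hqp.left.1 ▸ netVars_mono (List.subset_append_left as cs)
  have hpb : netVars A bs ⊆ p.dom := hqp.right.1 ▸ netVars_mono (List.subset_append_left bs cs)
  have upd : ∀ {Y : Set (Var σ)} {f g : PVal σ}, Y ⊆ f.dom → (∀ x ∈ Y, x ∈ X → g x = q₁ x) →
      (∀ x ∈ Y, x ∉ X → g x = f x) → (f.restrict Y).update (q₁.restrict X) = g.restrict Y := by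
    intro Y f g hf h₁ h₂
    funext x
    by_cases hY : x ∈ Y
    · rw [restrict_of_mem g hY]
      by_cases hxX : x ∈ X
      · rw [update_of_mem (by rw [dom_restrict]; exact ⟨hf hY, hY⟩)
          (by rw [dom_restrict]; exact ⟨hq₁X hxX, hxX⟩), restrict_of_mem _ hxX, h₁ x hY hxX]
      · rw [update_of_notMem (by rw [dom_restrict]; exact fun h => hxX h.2),
          restrict_of_mem _ hY, h₂ x hY hxX]
    · rw [restrict_of_notMem g hY, ← notMem_dom, dom_update, dom_restrict]
      exact fun h => hY h.2
  -- Seen from the other automata, a move of `cs` is just an update of the shared variables, under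
  -- which `R` is closed.
  have hR := h.sim.upd _ _ hqp.rel _ (restrict_mem_Val hq₁X)
  rw [upd hqa (g := q₁) (fun _ _ _ => rfl) fun x hx hxX =>
      hs.frame h.sep_a.right.ax hqc fun hc => hxX (h.mem_shared_iff_left.2 ⟨hx, hc⟩),
    upd hpb (g := splice (netVars A cs) q₁ p)
      (fun x _ hxX => splice_of_mem _ _ (h.mem_shared_iff_left.1 hxX).2)
      fun x hx hxX => splice_of_notMem _ _
        fun hc => hxX (h.mem_shared_iff_right.2 ⟨hx, hc⟩)] at hR
  have hag : ∀ x ∈ netVars A cs, q₁ x = splice (netVars A cs) q₁ p x :=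
    fun x hx => (splice_of_mem _ _ hx).symm
  refine ⟨_, hs', hq₁, mem_netStates_append (hs'.dom.trans hqp.right.1) ?_ ?_, hR, hag⟩
  -- The abstract invariants after the move come for free, since `R` relates states only.
  · exact h.rep_b.states ▸ (h.sim.subset _ _ hR).2
  · exact restrict_eq_restrict_iff.2 hag ▸ netStates_right hq₁

/-- The abstract automata follow the moves of the concrete ones. -/
theorem step_abstract (h : Abstraction A as bs cs Chan Na Nb Tc R)
    (hqp : Related A as bs cs R q p)
    (hs : (Na.restrict Chanᶜ (localExt A as cs)).Tr (q.restrict (netVars A as)) (.disc a) b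
      (q₁.restrict (netVars A as)))
    (hfr : ∀ x ∉ netVars A as, q₁ x = q x) (hq₁ : q₁ ∈ netStates A (as ++ cs)) :
    (∃ p₁ a', Flat A bs p a' b p₁ ∧ Related A as bs cs R q₁ p₁ ∧
      (a' = a ∨ a = .tau ∧ ∃ δ, .inl δ ∉ Chan ∧ a' = .bsend δ)) ∨
    (a = .tau ∧ Related A as bs cs R q₁ p) := by
  have hpb : netVars A bs ⊆ p.dom := hqp.right.1 ▸ netVars_mono (List.subset_append_left bs cs)
  -- Related states agree on the external variables, which are the shared ones.
  have shared : ∀ {s : PVal σ} {x : Var σ}, R (q₁.restrict (netVars A as)) s →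
      x ∈ netVars A as → x ∈ netVars A cs → q₁ x = s x := by
    intro s x hR ha hc
    have hx := h.mem_shared_iff_left.2 ⟨ha, hc⟩
    have he := h.sim.ext _ _ hR
    rw [← (h.comparable : _ = _), restrict_eq_restrict_iff] at he
    rw [← he x hx, restrict_of_mem _ ha]
  rcases h.sim.step _ _ hqp.rel _ b _ hs with ⟨s', hs', hR⟩ | ⟨ha, hR⟩
  · left
    have key : ∀ a', Nb.Tr (p.restrict (netVars A bs)) (.disc a') b s' →
        ∃ p₁, Flat A bs p a' b p₁ ∧ Related A as bs cs R q₁ p₁ := by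
      intro a' ht
      obtain ⟨-, hst, hfl⟩ := h.rep_b.sound _ _ _ _ ht
      have hfl' := hfl.extend h.sep_b.left.ax hpb
      have hres : (splice (netVars A bs) s' p).restrict (netVars A bs) = s' := by
        rw [restrict_eq_restrict_iff.2 fun x hx => splice_of_mem s' p hx,
          restrict_eq_self hst.1.subset]
      have hag : ∀ x ∈ netVars A cs, q₁ x = splice (netVars A bs) s' p x := by
        intro x hx
        by_cases hb : x ∈ netVars A bs
        · rw [splice_of_mem _ _ hb]
          have := h.mem_shared_iff_left.1 (h.mem_shared_iff_right.2 ⟨hb, hx⟩)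
          exact shared hR this.1 this.2
        -- A variable of `cs` that is not shared with `bs` is not shared with `as` either, so
        -- neither side has changed it.
        · rw [splice_of_notMem _ _ hb, hfr x fun ha => hb
            (h.mem_shared_iff_right.1 (h.mem_shared_iff_left.2 ⟨ha, hx⟩)).1, hqp.agree x hx]
      refine ⟨_, hfl', hq₁, mem_netStates_append (hfl'.dom.trans hqp.right.1) ?_ ?_, ?_, hag⟩
      · rwa [hres]
      · exact restrict_eq_restrict_iff.2 hag ▸ netStates_right hq₁
      · rwa [hres]
    rcases hs' with ⟨ht, -⟩ | ⟨ha, -, a', ⟨δ, hδ, rfl⟩, ht⟩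
    · obtain ⟨p₁, hp₁, hr⟩ := key a ht
      exact ⟨p₁, a, hp₁, hr, .inl rfl⟩
    · obtain ⟨p₁, hp₁, hr⟩ := key (.bsend δ) ht
      exact ⟨p₁, _, hp₁, hr, .inr ⟨by simpa using ha, δ, hδ, rfl⟩⟩
  · have ha' : a = .tau := by simpa using ha
    refine .inr ⟨ha', hq₁, hqp.right, hR, fun x hx => ?_⟩
    by_cases hxa : x ∈ netVars A as
    · have hb := (h.mem_shared_iff_right.1 (h.mem_shared_iff_left.2 ⟨hxa, hx⟩)).1
      rw [shared hR hxa hx, restrict_of_mem _ hb]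
    · rw [hfr x hxa, hqp.agree x hx]

theorem concrete_tr (h : Abstraction A as bs cs Chan Na Nb Tc R) {q q₁ : PVal σ}
    (hs : Flat A as q a b q₁) (hq : q ∈ netStates A (as ++ cs))
    (hq₁ : q₁ ∈ netStates A (as ++ cs))
    (hc : a = .tau → b = true ∨ ∀ k ∈ as ++ cs, ¬ (A k).Committed q) :
    Na.Tr (q.restrict (netVars A as)) (.disc a) b (q₁.restrict (netVars A as)) :=
  h.rep_a.complete _ _ _ _ (netStates_left hq) (netStates_left hq₁)
    (hs.restrict h.sep_a.left.ax subset_rfl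
      (hq.1 ▸ netVars_mono (List.subset_append_left as cs)))
    fun ha => (hc ha).imp_right fun hc k hk => (committed_restrict_iff hk).not.2
      (hc k (List.mem_append_left cs hk))

theorem common_tr (h : Abstraction A as bs cs Chan Na Nb Tc R) {q q₁ : PVal σ}
    (hs : Flat A cs q a b q₁) (hq : q ∈ netStates A (as ++ cs))
    (hq₁ : q₁ ∈ netStates A (as ++ cs)) (ha : a ≠ .tau) :
    Tc.Tr (q.restrict (netVars A cs)) (.disc a) b (q₁.restrict (netVars A cs)) :=
  h.rep_c.complete _ _ _ _ (netStates_right hq) (netStates_right hq₁)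
    (hs.restrict h.sep_a.right.ax subset_rfl
      (hq.1 ▸ netVars_mono (List.subset_append_right as cs))) fun ha' => absurd ha' ha

theorem unused_bcast (h : Abstraction A as bs cs Chan Na Nb Tc R) {δ : σ.Bcast}
    (hδ : .inl δ ∉ Chan) : (∀ s b t, ¬ Tc.Tr s (.disc (.bsend δ)) b t) ∧
      ∀ s ∈ Tc.S, ∀ b t, Tc.Tr s (.disc (.brecv δ)) b t ↔ b = false ∧ t = s :=
  not_not.1 fun hn => hδ (h.used hn)

/-- An internal move of the concrete automata is matched by at most one move of the abstract
network. -/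
theorem step_tau (h : Abstraction A as bs cs Chan Na Nb Tc R)
    (hqp : Related A as bs cs R q p)
    (hs : (Na.restrict Chanᶜ (localExt A as cs)).Tr (q.restrict (netVars A as)) (.disc .tau) b
      (q₁.restrict (netVars A as)))
    (hfr : ∀ x ∉ netVars A as, q₁ x = q x) (hq₁ : q₁ ∈ netStates A (as ++ cs)) :
    (∃ p₁ a', a'.IsStep ∧ Flat A (bs ++ cs) p a' b p₁ ∧ Related A as bs cs R q₁ p₁) ∨
      Related A as bs cs R q₁ p := by
  have hpd : netVars A (bs ++ cs) ⊆ p.dom := hqp.right.1.symm.subset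
  rcases h.step_abstract hqp hs hfr hq₁ with ⟨p₁, a', hf, hr, rfl | ⟨-, δ, hδ, rfl⟩⟩ | ⟨-, hr⟩
  · exact .inl ⟨p₁, .tau, trivial, (Dec.single p .tau b p₁ trivial hf).flat h.sep_b hpd, hr⟩
  · have hpc : netVars A cs ⊆ p₁.dom :=
      hr.right.1 ▸ netVars_mono (List.subset_append_right bs cs)
    -- The answer is a hidden broadcast. Its channel is unused by `cs`, whose self-loop completes it
    -- to a broadcast of the whole abstract network.
    obtain ⟨-, -, hl⟩ := h.rep_c.sound _ _ _ _ (((h.unused_bcast hδ).2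
      (p₁.restrict (netVars A cs)) (h.rep_c.states ▸ netStates_right hr.right) false _).2
      ⟨rfl, rfl⟩)
    have hl' : Flat A cs p₁ (.brecv δ) false p₁ :=
      hl.transfer h.sep_b.right.ax subset_rfl
        (by rw [dom_restrict]; exact fun x hx => ⟨hpc hx, hx⟩) hpc
        (fun x hx => restrict_of_mem p₁ hx) (fun x hx => (restrict_of_mem p₁ hx).symm)
        fun _ _ => rfl
    have := (Dec.bsend p δ b false p₁ p₁ hf hl').flat h.sep_b hpd
    rw [Bool.or_false] at this
    exact .inl ⟨p₁, .bsend δ, trivial, this, hr⟩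
  · exact .inr hr

/-- The move is split by its initiating group, and each half is matched by `step_abstract` or
`step_common`. Since the first answer leads to related states again, the second half starts from
there. -/
theorem step_disc (h : Abstraction A as bs cs Chan Na Nb Tc R)
    (hqp : Related A as bs cs R q p) {q' : PVal σ} (ha : a.IsStep)
    (hs : Flat A (as ++ cs) q a b q') (hq' : q' ∈ netStates A (as ++ cs))
    (hc : b = true ∨ ∀ k ∈ as ++ cs, ¬ (A k).Committed q) :
    (∃ p' a', a'.IsStep ∧ Flat A (bs ++ cs) p a' b p' ∧ Related A as bs cs R q' p') ∨
      Related A as bs cs R q' p := by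
  have hq := hqp.left
  have hpd : netVars A (bs ++ cs) ⊆ p.dom := hqp.right.1.symm.subset
  have hqa : netVars A as ⊆ q.dom := hq.1 ▸ netVars_mono (List.subset_append_left as cs)
  have vis : ∀ {q q₁ : PVal σ} {a : DAct σ} {b : Bool}, Flat A as q a b q₁ →
      q ∈ netStates A (as ++ cs) → q₁ ∈ netStates A (as ++ cs) →
      (a = .tau → b = true ∨ ∀ k ∈ as ++ cs, ¬ (A k).Committed q) →
      Act.disc a ∉ TTSB.removed Chanᶜ → Act.disc a ∉ TTSB.hidden Chanᶜ →
      (Na.restrict Chanᶜ (localExt A as cs)).Tr (q.restrict (netVars A as)) (.disc a) b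
        (q₁.restrict (netVars A as)) := fun hf hq hq₁ hc h₁ h₂ =>
    .inl ⟨h.concrete_tr hf hq hq₁ hc, h₁, h₂⟩
  have visible : ∀ {q p q₁ : PVal σ} {a : DAct σ} {b : Bool}, Related A as bs cs R q p →
      Flat A as q a b q₁ → q₁ ∈ netStates A (as ++ cs) → a ≠ .tau →
      Act.disc a ∉ TTSB.removed Chanᶜ → Act.disc a ∉ TTSB.hidden Chanᶜ →
      ∃ p₁, Flat A bs p a b p₁ ∧ Related A as bs cs R q₁ p₁ := by
    intro q p q₁ a b hqp hf hq₁ ha h₁ h₂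
    rcases h.step_abstract hqp (vis hf hqp.left hq₁ (fun h => absurd h ha) h₁ h₂)
      (fun x hx => hf.frame h.sep_a.left.ax
        (hqp.left.1 ▸ netVars_mono (List.subset_append_left as cs)) hx) hq₁ with
      ⟨p₁, a', hp₁, hr, rfl | ⟨h0, -⟩⟩ | ⟨h0, -⟩
    · exact ⟨p₁, hp₁, hr⟩
    · exact absurd h0 ha
    · exact absurd h0 ha
  rcases hs.dec h.sep_a hq.1.symm.subset with hs | hs
  · cases hs with
    | single a b q' hl hf =>
      cases a with
      | tau =>
        exact h.step_tau hqp (vis hf hq hq' (fun _ => hc) (by simp [TTSB.removed])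
          (by simp [TTSB.hidden])) (fun x hx => hf.frame h.sep_a.left.ax hqa hx) hq'
      | _ => first | exact hl.elim | exact ha.elim
    | sync c b b' q₁ q' hf hg =>
      have hq₁ := hf.mid_mem_netStates hg h.sep_a hq hq'
      -- The matching receive is a transition of `Tc`, so `c` is used and the send survives the
      -- restriction.
      have hch : .inr c ∈ Chan := h.used ⟨_, _, _, .inr (h.common_tr hg hq₁ hq' nofun)⟩
      obtain ⟨p₁, hp₁, hr⟩ := visible hqp hf hq₁ nofun (by simp [TTSB.removed, hch])
        (by simp [TTSB.hidden])
      obtain ⟨p', hp', hr'⟩ := h.step_common hr hg hq'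
      exact .inl ⟨p', .tau, trivial, (Dec.sync p c b b' p₁ p' hp₁ hp').flat h.sep_b hpd, hr'⟩
    | bsend δ b b' q₁ q' hf hg =>
      have hq₁ := hf.mid_mem_netStates hg h.sep_a hq hq'
      by_cases hch : .inl δ ∈ Chan
      · obtain ⟨p₁, hp₁, hr⟩ := visible hqp hf hq₁ nofun (by simp [TTSB.removed])
          (by simp [TTSB.hidden, hch])
        obtain ⟨p', hp', hr'⟩ := h.step_common hr hg hq'
        exact .inl ⟨p', .bsend δ, trivial,
          (Dec.bsend p δ b b' p₁ p' hp₁ hp').flat h.sep_b hpd, hr'⟩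
      -- Outside `Chan` the common automata only loop, so the broadcast changes nothing in them and
      -- contributes no commitment.
      · obtain ⟨rfl, he⟩ := ((h.unused_bcast hch).2 _
          (h.rep_c.states ▸ netStates_right hq₁) _ _).1 (h.common_tr hg hq₁ hq' nofun)
        have hqq : q' = q₁ := by
          funext x
          by_cases hx : x ∈ netVars A cs
          · exact restrict_eq_restrict_iff.1 he x hx
          · exact hg.frame h.sep_a.right.ax
              (hq₁.1 ▸ netVars_mono (List.subset_append_right as cs)) hx
        subst hqq
        rw [Bool.or_false] at hc ⊢
        -- The restriction turns this broadcast into τ. Its priority condition holds because an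
        -- uncommitted step of the network excludes committed locations, hence committed
        -- transitions.
        refine h.step_tau hqp (.inr ⟨rfl, fun hC => hc.resolve_right fun hc => ?_, _, ⟨δ, hch, rfl⟩,
          h.concrete_tr hf hq hq' nofun⟩) (fun x hx => hf.frame h.sep_a.left.ax hqa hx) hq'
        obtain ⟨k, hk, hk'⟩ := h.rep_a.committed h.sep_a.left hC
        exact hc k (List.mem_append_left cs hk) ((committed_restrict_iff hk).1 hk')
    | brecv => exact ha.elim
  · cases hs with
    | single a b q' hl hf =>
      cases a with
      | tau =>
        obtain ⟨p', hp', hr'⟩ := h.step_common hqp hf hq'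
        exact .inl ⟨p', .tau, trivial,
          (Dec.single p .tau b p' trivial hp').flat_swap h.sep_b hpd, hr'⟩
      | _ => first | exact hl.elim | exact ha.elim
    | sync c b b' q₁ q' hf hg =>
      have hq₁ : q₁ ∈ netStates A (as ++ cs) := netStates_append_comm ▸
        hf.mid_mem_netStates hg h.sep_a.swap (netStates_append_comm ▸ hq)
          (netStates_append_comm ▸ hq')
      have hch : .inr c ∈ Chan := h.used ⟨_, _, _, .inl (h.common_tr hf hq hq₁ nofun)⟩
      obtain ⟨p₁, hp₁, hr⟩ := h.step_common hqp hf hq₁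
      obtain ⟨p', hp', hr'⟩ := visible hr hg hq' nofun (by simp [TTSB.removed, hch])
        (by simp [TTSB.hidden])
      exact .inl ⟨p', .tau, trivial, (Dec.sync p c b b' p₁ p' hp₁ hp').flat_swap h.sep_b hpd, hr'⟩
    | bsend δ b b' q₁ q' hf hg =>
      have hq₁ : q₁ ∈ netStates A (as ++ cs) := netStates_append_comm ▸
        hf.mid_mem_netStates hg h.sep_a.swap (netStates_append_comm ▸ hq)
          (netStates_append_comm ▸ hq')
      -- An unused channel has no sender in `Tc`.
      have hch : .inl δ ∈ Chan := not_not.1 fun hch =>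
        (h.unused_bcast hch).1 _ _ _ (h.common_tr hf hq hq₁ nofun)
      obtain ⟨p₁, hp₁, hr⟩ := h.step_common hqp hf hq₁
      obtain ⟨p', hp', hr'⟩ := visible hr hg hq' nofun (by simp [TTSB.removed, hch])
        (by simp [TTSB.hidden])
      exact .inl ⟨p', .bsend δ, trivial,
        (Dec.bsend p δ b b' p₁ p' hp₁ hp').flat_swap h.sep_b hpd, hr'⟩
    | brecv => exact ha.elim

/-- The delay is answered through `R` by the abstract automata; the common ones can delay because
they see the same values on both sides. -/
theorem step_time (h : Abstraction A as bs cs Chan Na Nb Tc R)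
    (hqp : Related A as bs cs R q p) {d : ℝ≥0} (hd : CanDelay A (as ++ cs) q)
    (hq' : q.delay d ∈ netStates A (as ++ cs)) :
    CanDelay A (bs ++ cs) p ∧ Related A as bs cs R (q.delay d) (p.delay d) := by
  obtain ⟨hda, hdc⟩ := CanDelay.append.1 hd
  have hag : ∀ x ∈ netVars A cs, q.delay d x = p.delay d x :=
    fun x hx => delay_congr (hqp.agree x hx) d
  have ht := (h.rep_a.time (q.restrict (netVars A as)) d false
    ((q.delay d).restrict (netVars A as))).2 ⟨netStates_left hqp.left, netStates_left hq', rfl,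
      (delay_restrict q _ d).symm, CanDelay.restrict_iff.2 hda⟩
  rcases h.sim.step _ _ hqp.rel _ _ _
    (.inl ⟨ht, by simp [TTSB.removed], by simp [TTSB.hidden]⟩) with ⟨s', hs', hR⟩ | ⟨h0, -⟩
  · rcases hs' with ⟨hs', -⟩ | ⟨h0, -⟩
    · obtain ⟨-, hst, -, rfl, hdb⟩ := (h.rep_b.time _ _ _ _).1 hs'
      rw [delay_restrict] at hst hR
      refine ⟨CanDelay.append.2 ⟨CanDelay.restrict_iff.1 hdb, (CanDelay.congr hqp.agree).1 hdc⟩,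
        hq', mem_netStates_append ((dom_delay p d).trans hqp.right.1) hst ?_, hR, hag⟩
      exact restrict_eq_restrict_iff.2 hag ▸ netStates_right hq'
    · cases h0
  · cases h0

/-- Every step of the concrete network is matched by at most one step of the abstract network. -/
theorem step (h : Abstraction A as bs cs Chan Na Nb Tc R)
    (hqp : Related A as bs cs R q p) {act : Act σ} {q' : PVal σ}
    (hs : (netLTS A (as ++ cs)).Tr q act q') :
    ∃ p', Related A as bs cs R q' p' ∧ (p' = p ∨ (netLTS A (bs ++ cs)).Tr p act p') := by
  obtain ⟨hq, hq', hs⟩ := hs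
  cases act with
  | disc act =>
    obtain ⟨rfl, a, b, ha, hf, hc⟩ := hs.flat h.sep_a hq.1.symm.subset
    rcases h.step_disc hqp ha hf hq' hc with ⟨p', a', ha', hf', hr⟩ | hr
    · refine ⟨p', hr, .inr ⟨hqp.right, hr.right, ?_⟩⟩
      exact hf'.netRule h.sep_b hqp.right.1.symm.subset ha'
        (hc.imp_right (h.related_not_committed hqp))
    · exact ⟨p, hr, .inl rfl⟩
  | time d =>
    cases hs with
    | time _ hc hu =>
      obtain ⟨hd, hr⟩ := h.step_time hqp ⟨hc, hu⟩ hq'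
      exact ⟨_, hr, .inr ⟨hqp.right, hr.right, .time p d hd.1 hd.2⟩⟩

theorem reachable (h : Abstraction A as bs cs Chan Na Nb Tc R)
    (h0 : Related A as bs cs R (netInit A (as ++ cs)) (netInit A (bs ++ cs)))
    (hq : (netLTS A (as ++ cs)).Reachable q) :
    ∃ p, (netLTS A (bs ++ cs)).Reachable p ∧ Related A as bs cs R q p := by
  induction hq with
  | refl => exact ⟨_, .refl, h0⟩
  | tail _ hs ih =>
    obtain ⟨p, hp, hr⟩ := ih
    obtain ⟨act, hs⟩ := hs
    obtain ⟨p', hr', rfl | hs'⟩ := h.step hr hs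
    · exact ⟨p', hp, hr'⟩
    · exact ⟨p', hp.tail ⟨act, hs'⟩, hr'⟩

end Abstraction

end Simulation

/-! ### The theorem. -/

theorem mainTheorem5 {σ : Sig} (A : (k : σ.Name) → TA σ k)
    (as bs cs : List σ.Name) (has : as ≠ []) (hbs : bs ≠ []) (hcs : cs ≠ [])
    (hax : ∀ k ∈ as ++ bs ++ cs, (A k).Axioms)
    (hN : IsNTA A (as ++ cs)) (hN' : IsNTA A (bs ++ cs))
    (P : Set (PVal σ)) (hP : P ⊆ Val (netVars A cs))
    (Tc : TTSB σ) (hTc : Tc = netTTSB A cs)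
    (Chan : Set (σ.Bcast ⊕ σ.Bin)) (hChan : Tc.used ⊆ Chan)
    (Ta : TTSB σ) (hTa : Ta = (netTTSB A as).restrict Chanᶜ (localExt A as cs))
    (Tb : TTSB σ) (hTb : Tb = (netTTSB A bs).restrict Chanᶜ (localExt A as cs))
    (hcomp : Ta.Comparable Tb) (hsim : Ta.Le Tb)
    (hside : (Ta.par Tc).SideCondition Set.univ)
    (hurg : (∃ k ∈ as, (A k).urgent.Nonempty) →
      ∀ s ∈ Tb.S, (∃ k ∈ bs, (A k).Committed s) → Tb.Comm s)
    (hsafe : IsSafety A (bs ++ cs) (netVars A cs) P) :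
    IsSafety A (as ++ cs) (netVars A cs) P := by
  subst hTc hTa hTb
  obtain ⟨R, hR⟩ := hsim
  have sa : Separated A (as ++ cs) := hN.separated fun k hk => hax k <| by
    simp only [List.mem_append] at hk ⊢
    tauto
  have sb : Separated A (bs ++ cs) := hN'.separated fun k hk => hax k <| by
    simp only [List.mem_append] at hk ⊢
    tauto
  have rb := represents_netTTSB sb.left hbs
  have h : Abstraction A as bs cs Chan (netTTSB A as) (netTTSB A bs) (netTTSB A cs) R :=
    ⟨sa, sb, represents_netTTSB sa.left has, rb, represents_netTTSB sa.right hcs, hChan, hcomp, hR,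
      rb.states ▸ hurg⟩
  have ia := isInit_netInit hN
  have ib := isInit_netInit hN'
  have h0 : Related A as bs cs R (netInit A (as ++ cs)) (netInit A (bs ++ cs)) := by
    refine ⟨ia.mem_netStates, ib.mem_netStates, ?_, restrict_eq_restrict_iff.1
      ((ia.restrict (List.subset_append_right as cs)).unique
        (ib.restrict (List.subset_append_right bs cs)))⟩
    -- By uniqueness, each network's initial state restricts to the initial state of the composed
    -- TTSB, where `R` holds by assumption.
    rw [(ia.restrict (List.subset_append_left as cs)).unique (isInit_netTTSB hN.left has),
      (ib.restrict (List.subset_append_left bs cs)).unique (isInit_netTTSB hN'.left hbs)]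
    exact hR.init
  intro q hq
  obtain ⟨p, hp, hr⟩ := h.reachable h0 hq
  exact (Holds.congr hr.agree).2 (hsafe p hp)
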